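/- Let $G(x) = x\log x + (1-x)\log(1-x)$ on $[0,1]$ (with $0\log 0 = 0$, natural logarithm) be the negative Shannon entropy. For $x,y\in[0,1]$ let $D_G(y\,\|\,x) = G(y)-G(x)-(y-x)G'(x)$ be its Bregman divergence, i.e. the KL divergence between Bernoulli laws (with the usual values $D_G(x\,\|\,x)=0$ and $D_G(y\,\|\,x)=\infty$ for $y\ne x$ when $x\in\{0,1\}$), and let $\mathrm{JB}_G(a,b)=\frac{G(a)+G(b)}{2}-G\!\left(\frac{a+b}{2}\right)$. An *information structure* $\mathcal I$ consists of a probability space $(\Omega,\mathbb P)$, a random signal $\sigma:\Omega\to\mathcal S$ of Alice, a random signal $\tau:\Omega\to\mathcal T$ of Bob ($\mathcal S$, $\mathcal T$ arbitrary measurable spaces), and a random variable $Y:\Omega\to[0,1]$. For measurable $S\subseteq\mathcal S$, $T\subseteq\mathcal T$ write $\mu_{\sigma\tau}=\mathbb E[Y\mid\sigma,\tau]$, $\mu_{\sigma T}=\mathbb E[Y\mid \sigma,\ \tau\in T]$, $\mu_{S\tau}=\mathbb E[Y\mid \sigma\in S,\ \tau]$ and $\mu_{ST}=\mathbb E[Y\mid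 \sigma\in S,\ \tau\in T]$. $\mathcal I$ satisfies *rectangle substitutes with respect to $G$* if, for all measurable $S,T$ with $\mathbb P[\sigma\in S,\tau\in T]>0$, $$\mathbb E[D_G(Y\|\mu_{S\tau})\mid S,T]-\mathbb E[D_G(Y\|\mu_{\sigma\tau})\mid S,T]\le \mathbb E[D_G(Y\|\mu_{ST})\mid S,T]-\mathbb E[D_G(Y\|\mu_{\sigma T})\mid S,T],$$ where $\mid S,T$ means conditioning on $\sigma\in S,\ \tau\in T$. In a (deterministic) *communication protocol*, Alice and Bob send messages; each message is a (measurable) function of the sender's signal and of all previous messages, and whether the protocol has ended is determined by the messages sent so far; the protocol ends almost surely. Let $a$ (resp. $b$) be Alice's (resp. Bob's) expectation at the end of the protocol, that is, the conditional expectation of $Y$ given $\sigma$ (resp. $\tau$) and the final transcript. The protocol *causes Alice and Bob to $\epsilon$-agree* on $\mathcal I$ if $\mathbb E[\mathrm{JB}_G(a,b)]\le\epsilon$. After the protocol Alice is *$\delta$-accurate* if $\mathbb E[D_G(\mu_{\sigma\tau}\,\|\,a)]\le\delta$, and Bob is *$\delta$-accurate* if $\mathbb E[D_G(\mu_{\sigma\tau}\,\|\,b)]\le\delta$.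 **Statement.** There is an absolute constant $C>0$ such that for every $\epsilon\in(0,\tfrac12]$, every information structure $\mathcal I$ satisfying rectangle substitutes with respect to $G$, and every communication protocol that causes Alice and Bob to $\epsilon$-agree on $\mathcal I$, both Alice and Bob are $$C\,\epsilon^{1/3}\left(\log\tfrac1\epsilon\right)^{2/3}\text{-accurate}$$ after the protocol terminates. -/

import Mathlib

open MeasureTheory ProbabilityTheory
open scoped ENNReal

noncomputable section

/-! ### The negative Shannon entropy and its divergences -/

/-- `G(x) = x log x + (1 - x) log (1 - x)`, with `0 log 0 = 0`. -/
def negEntropy (x : ℝ) : ℝ := x * Real.log x + (1 - x) * Real.log (1 - x)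

/-- The Bregman divergence `D_G(y ‖ x) = G(y) - G(x) - (y - x) G'(x)` from `y` to `x`, for `G` the
negative Shannon entropy and `y ∈ [0, 1]`, i.e. the KL divergence of Bernoulli laws. At the end
points `x = 0, 1`, where `G` has infinite slope, it takes the usual value: `0` if `y = x`, and `∞`
otherwise. -/
def klBregman (y x : ℝ) : ℝ≥0∞ :=
  open Classical in
  if x ∈ Set.Ioo (0 : ℝ) 1 then
    ENNReal.ofReal (negEntropy y - negEntropy x - (y - x) * deriv negEntropy x)
  else if y = x then 0 else ⊤

/-- The Jensen-Bregman divergence of `G`. -/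
def jensenBregman (a b : ℝ) : ℝ :=
  (negEntropy a + negEntropy b) / 2 - negEntropy ((a + b) / 2)

/-! ### Information structures -/

/-- A probability space `(Ω, P)` with Alice's signal `σ`, Bob's signal `τ` and a `[0, 1]`-valued
random variable `Y`. -/
structure InfoStructure (Ω S T : Type*) [MeasurableSpace Ω] [MeasurableSpace S]
    [MeasurableSpace T] where
  P : Measure Ω
  isProb : IsProbabilityMeasure P
  σ : Ω → S
  τ : Ω → T
  Y : Ω → ℝ
  measurable_σ : Measurable σ
  measurable_τ : Measurable τ
  measurable_Y : Measurable Y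
  Y_mem : ∀ ω, Y ω ∈ Set.Icc (0 : ℝ) 1

attribute [instance] InfoStructure.isProb

namespace InfoStructure

variable {Ω S T : Type*} [MeasurableSpace Ω] [MeasurableSpace S] [MeasurableSpace T]
  (I : InfoStructure Ω S T)

/-- The "truth" `μ_{στ} = E[Y | σ, τ]`. -/
def truth : Ω → ℝ :=
  I.P[I.Y | MeasurableSpace.comap (fun ω => (I.σ ω, I.τ ω)) inferInstance]

/-- The event `σ ∈ A, τ ∈ B`. -/
def rect (A : Set S) (B : Set T) : Set Ω := I.σ ⁻¹' A ∩ I.τ ⁻¹' B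

/-- `μ_{σB} = E[Y | σ, τ ∈ B]`. -/
def muAlice (B : Set T) : Ω → ℝ :=
  (I.P[|I.τ ⁻¹' B])[I.Y | MeasurableSpace.comap I.σ inferInstance]

/-- `μ_{Aτ} = E[Y | σ ∈ A, τ]`. -/
def muBob (A : Set S) : Ω → ℝ :=
  (I.P[|I.σ ⁻¹' A])[I.Y | MeasurableSpace.comap I.τ inferInstance]

/-- `μ_{AB} = E[Y | σ ∈ A, τ ∈ B]`. -/
def muRect (A : Set S) (B : Set T) : ℝ := ∫ ω, I.Y ω ∂I.P[|I.rect A B]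

/-- `E[D_G(Y ‖ X) | σ ∈ A, τ ∈ B]`. -/
def condLoss (A : Set S) (B : Set T) (X : Ω → ℝ) : ℝ :=
  (∫⁻ ω, klBregman (I.Y ω) (X ω) ∂I.P[|I.rect A B]).toReal

/-- Rectangle substitutes with respect to `G`. -/
def RectangleSubstitutes : Prop :=
  ∀ (A : Set S) (B : Set T), MeasurableSet A → MeasurableSet B → I.P (I.rect A B) ≠ 0 →
    I.condLoss A B (I.muBob A) - I.condLoss A B I.truth ≤
      I.condLoss A B (fun _ => I.muRect A B) - I.condLoss A B (I.muAlice B)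

end InfoStructure

/-! ### Communication protocols -/

/-- A deterministic communication protocol with messages in `M`. The `n`-th message (`n = 0, 1, …`)
is sent by Alice if `aliceTurn n = true` and by Bob otherwise; it is a function of the sender's
signal and of the previous messages. The protocol ends at the first time `n` at which the `n`
messages sent so far lie in `halt n`. -/
structure Protocol (S T M : Type*) [MeasurableSpace S] [MeasurableSpace T]
    [MeasurableSpace M] where
  aliceTurn : ℕ → Bool
  alice : (n : ℕ) → (Fin n → M) → S → M
  bob : (n : ℕ) → (Fin n → M) → T → M
  halt : (n : ℕ) → Set (Fin n → M)
  measurable_alice : ∀ n, Measurable (fun q : (Fin n → M) × S => alice n q.1 q.2)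
  measurable_bob : ∀ n, Measurable (fun q : (Fin n → M) × T => bob n q.1 q.2)
  measurableSet_halt : ∀ n, MeasurableSet (halt n)

namespace Protocol

variable {Ω S T M : Type*} [MeasurableSpace Ω] [MeasurableSpace S] [MeasurableSpace T]
  [MeasurableSpace M] (π : Protocol S T M)

/-- The first `n` messages on inputs `s`, `t` (the messages are continued past the end of the
protocol, and never looked at there). -/
def transcript (s : S) (t : T) : (n : ℕ) → (Fin n → M)
  | 0 => Fin.elim0
  | n + 1 => Fin.snoc (α := fun _ => M) (transcript s t n)
      (if π.aliceTurn n = true then π.alice n (transcript s t n) s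
        else π.bob n (transcript s t n) t)

def Terminates (s : S) (t : T) : Prop := ∃ n, π.transcript s t n ∈ π.halt n

/-- The time at which the protocol ends. -/
def endTime (s : S) (t : T) : ℕ := sInf {n | π.transcript s t n ∈ π.halt n}

/-- The transcript at the end of the protocol. -/
def finalTranscript (s : S) (t : T) : Σ n : ℕ, (Fin n → M) :=
  ⟨π.endTime s t, π.transcript s t (π.endTime s t)⟩

variable (I : InfoStructure Ω S T)

/-- Alice's expectation at the end of the protocol: the conditional expectation of `Y` given her
signal and the transcript. Where the final transcript is one of positive probability, which occurs
exactly if `(σ, τ) ∈ A ×ˢ B`, this is almost surely `μ_{σB}`. -/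
def aliceExpectation : Ω → ℝ :=
  I.P[I.Y | MeasurableSpace.comap
    (fun ω => (I.σ ω, π.finalTranscript (I.σ ω) (I.τ ω))) inferInstance]

/-- Bob's expectation at the end of the protocol. -/
def bobExpectation : Ω → ℝ :=
  I.P[I.Y | MeasurableSpace.comap
    (fun ω => (I.τ ω, π.finalTranscript (I.σ ω) (I.τ ω))) inferInstance]

/-- The protocol ends (almost surely), and at its end `E[JB_G(a, b)] ≤ ε`. -/
def CausesAgreement (ε : ℝ) : Prop :=
  (∀ᵐ ω ∂I.P, π.Terminates (I.σ ω) (I.τ ω)) ∧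
    ∫ ω, jensenBregman (π.aliceExpectation I ω) (π.bobExpectation I ω) ∂I.P ≤ ε

/-- `E[D_G(μ_{στ} ‖ a)] ≤ δ`. -/
def AliceAccurate (δ : ℝ) : Prop :=
  ∫⁻ ω, klBregman (I.truth ω) (π.aliceExpectation I ω) ∂I.P ≤ ENNReal.ofReal δ

/-- `E[D_G(μ_{στ} ‖ b)] ≤ δ`. -/
def BobAccurate (δ : ℝ) : Prop :=
  ∫⁻ ω, klBregman (I.truth ω) (π.bobExpectation I ω) ∂I.P ≤ ENNReal.ofReal δ

end Protocol

end

/-! For a σ-algebra `m` put `U(m) = E[G(E[Y | m])]` (`expNegEntropy`). The expected divergence from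
`Y`, or from the truth, to a conditional expectation is a difference of values of `U`
(`lintegral_klBregman_condExp`). So Bob's inaccuracy is `U(A ∨ B) - U(B ∨ Π)`, with `Π` the
information in the transcript, and rectangle substitutes says that `U(A ∨ B) + U(⊥) ≤ U(A) + U(B)`
under the law conditioned on any rectangle. Summing over a countable partition `P` into rectangles
gives `U(A ∨ B) - U(B ∨ P) ≤ U(A ∨ P) - U(P)`.

Suppose that `Π` is such a partition `P`. Let Alice send one more, virtual message `Z`: the bin
containing her expectation `a`, in a grid of mesh `w` in the coordinate `√x - √(1 - x)`. The cells
of `P ∨ Z` are still rectangles, so `U(A ∨ B) - U(B ∨ P ∨ Z) ≤ U(A ∨ P) - U(P ∨ Z)`. The right side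
is `O(w²)`: the points of a bin have divergence `O(w²)` to a suitable centre
(`exists_bernoulliKL_le`). On the other hand `Z` tells Bob little. The Jensen-Bregman divergence
dominates the squared distance in this coordinate, so `a` and `b` are `√(8ε)` apart on average, and
some shift of the grid separates them with probability at most `√(8ε) / w`; otherwise Bob can
compute `Z` from `b`. Hence `Z` moves his expectation by `O(√ε / w)` in `L¹`, and `U` by at most a
logarithmic factor more. Balancing `w²` against `√ε log(1/ε) / w` gives the rate.

A general transcript is not discrete. Its information is approximated by discrete variables with
rectangular level sets (`RectangleApproximable`). These must also be almost functions of the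
transcript, as otherwise they would change the parties' expectations. The property passes from
message to message, and to the final transcript since the protocol almost surely ends. -/

noncomputable section

/-! ### Logarithmic inequalities and the Bernoulli divergence. -/

theorem negEntropy_eq_neg_binEntropy (x : ℝ) : negEntropy x = -Real.binEntropy x := by
  simp only [negEntropy, Real.binEntropy, Real.log_inv]; ring

theorem continuous_negEntropy : Continuous negEntropy := by
  have : negEntropy = fun x => -Real.binEntropy x := funext negEntropy_eq_neg_binEntropy
  rw [this]; exact Real.binEntropy_continuous.neg

theorem abs_negEntropy_le_one {x : ℝ} (hx : x ∈ Set.Icc (0 : ℝ) 1) : |negEntropy x| ≤ 1 := by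
  rw [negEntropy_eq_neg_binEntropy, abs_neg, abs_of_nonneg (Real.binEntropy_nonneg hx.1 hx.2)]
  exact Real.binEntropy_le_log_two.trans (Real.log_two_lt_d9.le.trans (by norm_num))

theorem deriv_negEntropy (x : ℝ) : deriv negEntropy x = Real.log x - Real.log (1 - x) := by
  have : negEntropy = fun x => -Real.binEntropy x := funext negEntropy_eq_neg_binEntropy
  rw [this, deriv.fun_neg, Real.deriv_binEntropy]; ring

/-- The tangent inequality of the relative entropy of unnormalised masses. -/
theorem mul_log_sub_mul_log_ge {y x : ℝ} (hy : 0 ≤ y) (hx : 0 < x) :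
    y - x ≤ y * Real.log y - y * Real.log x := by
  rcases hy.eq_or_lt with rfl | hy
  · simp [hx.le]
  · have h := Real.log_le_sub_one_of_pos (div_pos hx hy)
    rw [Real.log_div hx.ne' hy.ne'] at h
    have := mul_le_mul_of_nonneg_left h hy.le
    have e : y * (x / y - 1) = x - y := by field_simp
    rw [e] at this; linarith

theorem mul_log_sub_mul_log_le {y x : ℝ} (hy : 0 ≤ y) (hx : 0 < x) :
    y * Real.log y - y * Real.log x ≤ y * (y - x) / x := by
  rcases hy.eq_or_lt with rfl | hy
  · simp
  · have h := Real.log_le_sub_one_of_pos (div_pos hy hx)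
    rw [Real.log_div hy.ne' hx.ne'] at h
    have := mul_le_mul_of_nonneg_left h hy.le
    have e : y * (y / x - 1) = y * (y - x) / x := by field_simp
    rw [e] at this; linarith

/-- Squared Hellinger distance is at most relative entropy: apply `log t ≤ t - 1` at `t = √x / √y`.
-/
theorem sq_sqrt_sub_sqrt_le {y x : ℝ} (hy : 0 ≤ y) (hx : 0 < x) :
    (√y - √x) ^ 2 ≤ y * Real.log y - y * Real.log x - y + x := by
  rcases hy.eq_or_lt with rfl | hy
  · simp [Real.sq_sqrt hx.le]
  · have hsx := Real.sqrt_pos.2 hx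
    have hsy := Real.sqrt_pos.2 hy
    have h := Real.log_le_sub_one_of_pos (div_pos hsx hsy)
    rw [Real.log_div hsx.ne' hsy.ne', Real.log_sqrt hx.le, Real.log_sqrt hy.le] at h
    have := mul_le_mul_of_nonneg_left h hy.le
    have e : y * (√x / √y - 1) = √x * √y - y := by
      have : y = √y * √y := (Real.mul_self_sqrt hy.le).symm
      field_simp
      nlinarith
    rw [e] at this
    nlinarith [Real.sq_sqrt hx.le, Real.sq_sqrt hy.le]

/-- `D_G(y ‖ x)` in terms of logarithms. -/
def bernoulliKL (y x : ℝ) : ℝ :=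
  (y * Real.log y - y * Real.log x) +
    ((1 - y) * Real.log (1 - y) - (1 - y) * Real.log (1 - x))

theorem bernoulliKL_eq (y x : ℝ) :
    bernoulliKL y x =
      negEntropy y - negEntropy x - (y - x) * (Real.log x - Real.log (1 - x)) := by
  simp only [bernoulliKL, negEntropy]; ring

theorem bernoulliKL_nonneg {y x : ℝ} (hy : y ∈ Set.Icc (0 : ℝ) 1) (hx : x ∈ Set.Ioo (0 : ℝ) 1) :
    0 ≤ bernoulliKL y x := by
  have h1 := mul_log_sub_mul_log_ge hy.1 hx.1
  have h2 := mul_log_sub_mul_log_ge (sub_nonneg.2 hy.2) (sub_pos.2 hx.2)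
  unfold bernoulliKL; linarith

/-- The χ² bound on relative entropy: `log t ≤ t - 1` in both outcomes. -/
theorem bernoulliKL_le {y x : ℝ} (hy : y ∈ Set.Icc (0 : ℝ) 1) (hx : x ∈ Set.Ioo (0 : ℝ) 1) :
    bernoulliKL y x ≤ (y - x) ^ 2 / (x * (1 - x)) := by
  have h1 := mul_log_sub_mul_log_le hy.1 hx.1
  have h2 := mul_log_sub_mul_log_le (sub_nonneg.2 hy.2) (sub_pos.2 hx.2)
  have hx1 := hx.1
  have hx2 := sub_pos.2 hx.2
  have e : y * (y - x) / x + (1 - y) * (1 - y - (1 - x)) / (1 - x) =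
      (y - x) ^ 2 / (x * (1 - x)) := by
    field_simp; ring
  unfold bernoulliKL; linarith

theorem klBregman_of_mem_Ioo {y x : ℝ} (hx : x ∈ Set.Ioo (0 : ℝ) 1) :
    klBregman y x = ENNReal.ofReal (bernoulliKL y x) := by
  rw [klBregman, if_pos hx, deriv_negEntropy, bernoulliKL_eq]

theorem klBregman_self_zero : klBregman 0 0 = ENNReal.ofReal (bernoulliKL 0 0) := by
  simp [klBregman, bernoulliKL]

theorem klBregman_self_one : klBregman 1 1 = ENNReal.ofReal (bernoulliKL 1 1) := by
  simp [klBregman, bernoulliKL]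

/-! ### Modulus of continuity -/

/-- With `t = |x - y|`, the difference is at most `max t (-t log t)`. The free parameter `l`
replaces the concave function `-t log t` by an affine majorant, its tangent at `l`, which can be
integrated over `Ω`. -/
theorem abs_mul_log_sub_le {x y l : ℝ} (hx : x ∈ Set.Icc (0 : ℝ) 1) (hy : y ∈ Set.Icc (0 : ℝ) 1)
    (hl : 0 < l) (hl1 : l ≤ 1) :
    |x * Real.log x - y * Real.log y| ≤ |x - y| * (1 + Real.log (1 / l)) + l := by
  wlog hxy : x ≤ y generalizing x y
  · rw [abs_sub_comm, abs_sub_comm x]; exact this hy hx (le_of_not_ge hxy)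
  have hL : 0 ≤ Real.log (1 / l) := Real.log_nonneg (by rw [le_div_iff₀ hl]; linarith)
  rcases hxy.eq_or_lt with rfl | hxy
  · simp [hl.le]
  have hy0 : 0 < y := hx.1.trans_lt hxy
  have ht : 0 < y - x := sub_pos.2 hxy
  rw [abs_sub_comm x, abs_of_pos ht, abs_le]
  have hlogy : Real.log y ≤ 0 := Real.log_nonpos hy.1 hy.2
  constructor
  · have h := mul_log_sub_mul_log_ge hx.1 hy0
    nlinarith
  · have h1 : x * Real.log x - x * Real.log y ≤ 0 := by
      rcases hx.1.eq_or_lt with h | h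
      · simp [← h]
      · nlinarith [Real.log_le_log h hxy.le]
    have h2 : Real.log (y - x) ≤ Real.log y := Real.log_le_log ht (by linarith [hx.1])
    have h3 := Real.log_le_sub_one_of_pos (div_pos hl ht)
    rw [Real.log_div hl.ne' ht.ne'] at h3
    have h4 := mul_le_mul_of_nonneg_left h3 ht.le
    have e : (y - x) * (l / (y - x) - 1) = l - (y - x) := by field_simp
    rw [e] at h4
    rw [one_div, Real.log_inv]
    nlinarith

theorem abs_negEntropy_sub_le {x y l : ℝ} (hx : x ∈ Set.Icc (0 : ℝ) 1)
    (hy : y ∈ Set.Icc (0 : ℝ) 1) (hl : 0 < l) (hl1 : l ≤ 1) :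
    |negEntropy x - negEntropy y| ≤ 2 * (|x - y| * (1 + Real.log (1 / l)) + l) := by
  have h1 := abs_mul_log_sub_le hx hy hl hl1
  have h2 := abs_mul_log_sub_le (x := 1 - x) (y := 1 - y) ⟨sub_nonneg.2 hx.2, by linarith [hx.1]⟩
    ⟨sub_nonneg.2 hy.2, by linarith [hy.1]⟩ hl hl1
  have e : |1 - x - (1 - y)| = |x - y| := by rw [abs_sub_comm x]; congr 1; ring
  rw [e] at h2
  have e2 : negEntropy x - negEntropy y = (x * Real.log x - y * Real.log y) +
    ((1 - x) * Real.log (1 - x) - (1 - y) * Real.log (1 - y)) := by unfold negEntropy; ring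
  rw [e2]
  exact (abs_add_le _ _).trans (by linarith)

/-! ### Hellinger coordinates -/

/-- A coordinate on `[0, 1]` in which the divergences of `G` are comparable to squared distances. -/
def hellingerCoord (x : ℝ) : ℝ := √x - √(1 - x)

theorem continuous_hellingerCoord : Continuous hellingerCoord := by
  unfold hellingerCoord; fun_prop

/-- The right side is the mean relative entropy from `a` and `b` to their midpoint. Bound each by a
squared Hellinger distance and use `(u - v)² ≤ 2 (u² + v²)`. -/
theorem sq_sqrt_sub_sqrt_le_jensen {a b : ℝ} (ha : 0 ≤ a) (hb : 0 ≤ b) :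
    (√a - √b) ^ 2 / 4 ≤ (a * Real.log a + b * Real.log b) / 2 -
      (a + b) / 2 * Real.log ((a + b) / 2) := by
  rcases (add_nonneg ha hb).eq_or_lt with h | h
  · have ha0 : a = 0 := by linarith
    have hb0 : b = 0 := by linarith
    simp [ha0, hb0]
  · have hm : 0 < (a + b) / 2 := by linarith
    have h1 := sq_sqrt_sub_sqrt_le ha hm
    have h2 := sq_sqrt_sub_sqrt_le hb hm
    nlinarith [sq_nonneg ((√a - √((a + b) / 2)) + (√b - √((a + b) / 2)))]

theorem sq_hellingerCoord_sub_le {a b : ℝ} (ha : a ∈ Set.Icc (0 : ℝ) 1)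
    (hb : b ∈ Set.Icc (0 : ℝ) 1) :
    (hellingerCoord a - hellingerCoord b) ^ 2 ≤ 8 * jensenBregman a b := by
  have h1 := sq_sqrt_sub_sqrt_le_jensen ha.1 hb.1
  have h2 := sq_sqrt_sub_sqrt_le_jensen (sub_nonneg.2 ha.2) (sub_nonneg.2 hb.2)
  have e : (1 - a + (1 - b)) / 2 = 1 - (a + b) / 2 := by ring
  rw [e] at h2
  unfold hellingerCoord jensenBregman negEntropy
  nlinarith [sq_nonneg ((√a - √b) + (√(1 - a) - √(1 - b)))]

/-- Points that are close in the Hellinger coordinate are close in both square roots. -/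
theorem abs_sqrt_sub_sqrt_le_of_hellingerCoord {a b w : ℝ}
    (h : |hellingerCoord a - hellingerCoord b| ≤ w) :
    |√a - √b| ≤ w ∧ |√(1 - a) - √(1 - b)| ≤ w := by
  wlog hab : a ≤ b generalizing a b
  · rw [abs_sub_comm √a, abs_sub_comm √(1 - a)]
    exact this (by rwa [abs_sub_comm]) (le_of_not_ge hab)
  have h1 := Real.sqrt_le_sqrt hab
  have h2 : √(1 - b) ≤ √(1 - a) := Real.sqrt_le_sqrt (by linarith)
  have h3 := (abs_le.1 h).1
  unfold hellingerCoord at h3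
  rw [abs_le, abs_le]
  refine ⟨⟨?_, ?_⟩, ?_, ?_⟩ <;> linarith

/-- The centre `x` is `y` clamped to `[w², 1 - w²]`, which moves both square roots by at most `w`.
Staying `w²` away from the end points keeps `√x ≥ w`, so `|√a - √x| ≤ 2w` gives `|a - x| ≤ 8w√x`,
and likewise for `1 - x`. The χ² bound is then at most `64 w² / max x (1 - x) ≤ 128 w²`. -/
theorem exists_bernoulliKL_le {y w : ℝ} (hy : y ∈ Set.Icc (0 : ℝ) 1) (hw : 0 < w)
    (hw2 : w ≤ 1 / 2) :
    ∃ x ∈ Set.Icc (w ^ 2) (1 - w ^ 2), ∀ a ∈ Set.Icc (0 : ℝ) 1,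
      |hellingerCoord a - hellingerCoord y| ≤ w → bernoulliKL a x ≤ 128 * w ^ 2 := by
  have hww : w ^ 2 ≤ w := by nlinarith
  have key : ∃ x ∈ Set.Icc (w ^ 2) (1 - w ^ 2), |√y - √x| ≤ w ∧ |√(1 - y) - √(1 - x)| ≤ w := by
    have h1w : 1 - w ≤ √(1 - w ^ 2) := Real.le_sqrt_of_sq_le (by nlinarith)
    have hs1 : √(w ^ 2) = w := Real.sqrt_sq hw.le
    have hone : ∀ t : ℝ, 0 ≤ t → √(1 - t) ≤ 1 := fun t ht =>
      Real.sqrt_le_one.2 (by linarith)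
    rcases lt_or_ge y (w ^ 2) with h | h
    · refine ⟨w ^ 2, ⟨le_rfl, by nlinarith⟩, ?_, ?_⟩
      · rw [hs1, abs_le]
        have := Real.sqrt_le_sqrt h.le
        rw [hs1] at this
        constructor <;> linarith [Real.sqrt_nonneg y]
      · have h2 : √(1 - w ^ 2) ≤ √(1 - y) := Real.sqrt_le_sqrt (by linarith)
        rw [abs_le]
        constructor <;> linarith [hone y hy.1]
    · rcases lt_or_ge (1 - w ^ 2) y with h' | h'
      · refine ⟨1 - w ^ 2, ⟨by nlinarith, le_rfl⟩, ?_, ?_⟩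
        · have h2 : √(1 - w ^ 2) ≤ √y := Real.sqrt_le_sqrt h'.le
          have h3 : √y ≤ 1 := Real.sqrt_le_one.2 hy.2
          rw [abs_le]
          constructor <;> linarith
        · have e : 1 - (1 - w ^ 2) = w ^ 2 := by ring
          rw [e, hs1, abs_le]
          have := Real.sqrt_le_sqrt (show 1 - y ≤ w ^ 2 by linarith)
          rw [hs1] at this
          constructor <;> linarith [Real.sqrt_nonneg (1 - y)]
      · exact ⟨y, ⟨h, h'⟩, by simp [hw.le], by simp [hw.le]⟩
  obtain ⟨x, hx, k1, k2⟩ := key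
  refine ⟨x, hx, fun a ha hay => ?_⟩
  obtain ⟨l1, l2⟩ := abs_sqrt_sub_sqrt_le_of_hellingerCoord hay
  have d1 : |√a - √x| ≤ 2 * w := (abs_sub_le _ √y _).trans (by linarith)
  have d2 : |√(1 - a) - √(1 - x)| ≤ 2 * w := (abs_sub_le _ √(1 - y) _).trans (by linarith)
  have hw0 : 0 < w ^ 2 := by positivity
  have hx0 : 0 < x := hw0.trans_le hx.1
  have hx1 : 0 < 1 - x := by linarith [hx.2]
  -- squares of differences in terms of differences of square roots
  have aux : ∀ a x : ℝ, 0 ≤ a → w ^ 2 ≤ x → |√a - √x| ≤ 2 * w →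
      (a - x) ^ 2 ≤ 64 * w ^ 2 * x := by
    intro a x ha hx hd
    have hx0 : 0 ≤ x := hw0.le.trans hx
    have hwx : w ≤ √x := Real.le_sqrt_of_sq_le hx
    have e : a - x = (√a - √x) * (√a + √x) := by
      nlinarith [Real.sq_sqrt ha, Real.sq_sqrt hx0]
    have h4 : |√a + √x| ≤ 4 * √x := by
      rw [abs_of_nonneg (by positivity)]
      linarith [(abs_le.1 hd).2]
    have h5 : |a - x| ≤ 2 * w * (4 * √x) := by
      rw [e, abs_mul]
      exact mul_le_mul hd h4 (abs_nonneg _) (by positivity)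
    calc (a - x) ^ 2 = |a - x| ^ 2 := (sq_abs _).symm
      _ ≤ (2 * w * (4 * √x)) ^ 2 := pow_le_pow_left₀ (abs_nonneg _) h5 2
      _ = 64 * w ^ 2 * (√x) ^ 2 := by ring
      _ = 64 * w ^ 2 * x := by rw [Real.sq_sqrt hx0]
  have s1 := aux a x ha.1 hx.1 d1
  have s2 := aux (1 - a) (1 - x) (sub_nonneg.2 ha.2) (by linarith [hx.2]) d2
  refine (bernoulliKL_le ha ⟨hx0, by linarith⟩).trans ?_
  rw [div_le_iff₀ (by positivity)]
  rcases le_total x (1 / 2) with h | h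
  · have : 0 ≤ w ^ 2 * x := by positivity
    nlinarith
  · have : 0 ≤ w ^ 2 * (1 - x) := by positivity
    nlinarith

/-! ### Expected divergence to a conditional expectation. -/

theorem aestronglyMeasurable_condExp {Ω : Type*} {m m0 : MeasurableSpace Ω} {μ : Measure Ω}
    {Y : Ω → ℝ} : AEStronglyMeasurable (μ[Y|m]) μ :=
  integrable_condExp.aestronglyMeasurable

section Loss

variable {Ω : Type*} {m m0 : MeasurableSpace Ω} {μ : Measure Ω} [IsProbabilityMeasure μ]
  {Y X : Ω → ℝ}

theorem integrable_of_mem_Icc (hY : AEStronglyMeasurable Y μ)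
    (hY01 : ∀ᵐ ω ∂μ, Y ω ∈ Set.Icc (0 : ℝ) 1) : Integrable Y μ := by
  refine Integrable.of_bound hY 1 (hY01.mono fun ω h => ?_)
  rw [Real.norm_eq_abs, abs_of_nonneg h.1]; exact h.2

theorem condExp_mem_Icc (hm : m ≤ m0) (hY : AEStronglyMeasurable Y μ)
    (hY01 : ∀ᵐ ω ∂μ, Y ω ∈ Set.Icc (0 : ℝ) 1) : ∀ᵐ ω ∂μ, μ[Y|m] ω ∈ Set.Icc (0 : ℝ) 1 := by
  have hi := integrable_of_mem_Icc hY hY01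
  have h0 : 0 ≤ᵐ[μ] μ[Y|m] := condExp_nonneg (hY01.mono fun ω h => h.1)
  have h1 : μ[Y|m] ≤ᵐ[μ] μ[fun _ => (1 : ℝ)|m] :=
    condExp_mono hi (integrable_const _) (hY01.mono fun ω h => h.2)
  rw [condExp_const hm] at h1
  filter_upwards [h0, h1] with ω h0 h1 using ⟨h0, h1⟩

theorem integrable_negEntropy_comp (hX : AEStronglyMeasurable X μ)
    (hX01 : ∀ᵐ ω ∂μ, X ω ∈ Set.Icc (0 : ℝ) 1) : Integrable (fun ω => negEntropy (X ω)) μ := by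
  refine Integrable.of_bound (continuous_negEntropy.comp_aestronglyMeasurable hX) 1
    (hX01.mono fun ω h => abs_negEntropy_le_one h)

/-- Pulling a nonnegative measurable factor out of a conditional expectation. -/
theorem lintegral_ofReal_condExp_mul (hm : m ≤ m0) (hY : Integrable Y μ) (hY0 : 0 ≤ᵐ[μ] Y)
    {F : Ω → ℝ≥0∞} (hF : Measurable[m] F) :
    ∫⁻ ω, ENNReal.ofReal (μ[Y|m] ω) * F ω ∂μ = ∫⁻ ω, ENNReal.ofReal (Y ω) * F ω ∂μ := by
  have hX0 : 0 ≤ᵐ[μ] μ[Y|m] := condExp_nonneg hY0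
  have hYm : AEMeasurable (fun ω => ENNReal.ofReal (Y ω)) μ :=
    hY.aestronglyMeasurable.aemeasurable.ennreal_ofReal
  have hXm : AEMeasurable (fun ω => ENNReal.ofReal (μ[Y|m] ω)) μ :=
    integrable_condExp.aestronglyMeasurable.aemeasurable.ennreal_ofReal
  have hFm : AEMeasurable F μ := (hF.mono hm le_rfl).aemeasurable
  -- As densities, `Y` and `μ[Y|m]` define the same measure on `m`, and the `m`-measurable `F` sees
  -- nothing else.
  have key : (μ.withDensity (fun ω => ENNReal.ofReal (μ[Y|m] ω))).trim hm =
      (μ.withDensity (fun ω => ENNReal.ofReal (Y ω))).trim hm := by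
    refine @Measure.ext _ m _ _ fun s hs => ?_
    rw [trim_measurableSet_eq hm hs, trim_measurableSet_eq hm hs,
      withDensity_apply _ (hm s hs), withDensity_apply _ (hm s hs),
      ← ofReal_integral_eq_lintegral_ofReal integrable_condExp.integrableOn
        (ae_restrict_of_ae hX0),
      ← ofReal_integral_eq_lintegral_ofReal hY.integrableOn (ae_restrict_of_ae hY0),
      setIntegral_condExp hm hY hs]
  have h1 := lintegral_withDensity_eq_lintegral_mul₀ hXm hFm
  have h2 := lintegral_withDensity_eq_lintegral_mul₀ hYm hFm
  simp only [Pi.mul_apply] at h1 h2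
  rw [← h1, ← h2, ← lintegral_trim hm hF, ← lintegral_trim hm hF, key]

/-- The factor `log X` is unbounded and not known to be integrable. It has a constant sign, so the
pull-out identity is taken for lower integrals; integrability then follows from the boundedness of
`x log x`. -/
theorem integrable_mul_log_condExp (hm : m ≤ m0) (hY : AEStronglyMeasurable Y μ)
    (hY01 : ∀ᵐ ω ∂μ, Y ω ∈ Set.Icc (0 : ℝ) 1) (hX : X =ᵐ[μ] μ[Y|m]) :
    Integrable (fun ω => Y ω * Real.log (X ω)) μ ∧
      ∫ ω, Y ω * Real.log (X ω) ∂μ = ∫ ω, X ω * Real.log (X ω) ∂μ := by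
  have hi := integrable_of_mem_Icc hY hY01
  have hY0 : 0 ≤ᵐ[μ] Y := hY01.mono fun ω h => h.1
  set Z := μ[Y|m] with hZ
  have hZ01 : ∀ᵐ ω ∂μ, Z ω ∈ Set.Icc (0 : ℝ) 1 := condExp_mem_Icc hm hY hY01
  have hZm : Measurable[m] Z := stronglyMeasurable_condExp.measurable
  have hZm0 : AEStronglyMeasurable Z μ := aestronglyMeasurable_condExp
  have hF : Measurable[m] fun ω => ENNReal.ofReal (-Real.log (Z ω)) :=
    (Real.measurable_log.comp hZm).neg.ennreal_ofReal
  have hlin := lintegral_ofReal_condExp_mul hm hi hY0 hF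
  have hZZ : Integrable (fun ω => Z ω * -Real.log (Z ω)) μ := by
    have hc : Continuous fun x : ℝ => x * Real.log x := Real.continuous_mul_log
    refine Integrable.of_bound ?_ 1 (hZ01.mono fun ω h => ?_)
    · have := (hc.comp_aestronglyMeasurable hZm0).neg
      refine this.congr (.of_forall fun ω => ?_)
      simp
    · have := abs_mul_log_sub_le h (y := 0) ⟨le_rfl, zero_le_one⟩ one_pos le_rfl
      have h3 := mul_log_sub_mul_log_ge h.1 one_pos
      have h4 := Real.log_nonpos h.1 h.2
      rw [Real.norm_eq_abs, abs_le]
      simp at h3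
      constructor <;> nlinarith [h.1, h.2]
  have e : ∀ W : Ω → ℝ, (∀ᵐ ω ∂μ, W ω ∈ Set.Icc (0 : ℝ) 1) →
      (fun ω => ENNReal.ofReal (W ω) * ENNReal.ofReal (-Real.log (Z ω))) =ᵐ[μ]
      fun ω => ENNReal.ofReal (W ω * -Real.log (Z ω)) := fun W hW =>
    hW.mono fun ω h => (ENNReal.ofReal_mul h.1).symm
  rw [lintegral_congr_ae (e Z hZ01), lintegral_congr_ae (e Y hY01)] at hlin
  have pos : ∀ W : Ω → ℝ, (∀ᵐ ω ∂μ, W ω ∈ Set.Icc (0 : ℝ) 1) →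
      0 ≤ᵐ[μ] fun ω => W ω * -Real.log (Z ω) := fun W hW => by
    filter_upwards [hW, hZ01] with ω h1 h2
    exact mul_nonneg h1.1 (neg_nonneg.2 (Real.log_nonpos h2.1 h2.2))
  have hYZm : AEStronglyMeasurable (fun ω => Y ω * -Real.log (Z ω)) μ :=
    hY.mul (Real.measurable_log.comp_aemeasurable hZm0.aemeasurable).neg.aestronglyMeasurable
  have hYZ : Integrable (fun ω => Y ω * -Real.log (Z ω)) μ := by
    refine ⟨hYZm, ?_⟩
    rw [hasFiniteIntegral_iff_ofReal (pos Y hY01), ← hlin,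
      ← hasFiniteIntegral_iff_ofReal (pos Z hZ01)]
    exact hZZ.2
  have hint : ∫ ω, Y ω * -Real.log (Z ω) ∂μ = ∫ ω, Z ω * -Real.log (Z ω) ∂μ := by
    rw [integral_eq_lintegral_of_nonneg_ae (pos Y hY01) hYZm,
      integral_eq_lintegral_of_nonneg_ae (pos Z hZ01) hZZ.1, hlin]
  have eX : (fun ω => Y ω * Real.log (X ω)) =ᵐ[μ] fun ω => -(Y ω * -Real.log (Z ω)) :=
    hX.mono fun ω h => by simp only [h]; ring
  have eX2 : (fun ω => X ω * Real.log (X ω)) =ᵐ[μ] fun ω => -(Z ω * -Real.log (Z ω)) :=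
    hX.mono fun ω h => by simp only [h]; ring
  refine ⟨hYZ.neg.congr eX.symm, ?_⟩
  rw [integral_congr_ae eX, integral_congr_ae eX2, integral_neg, integral_neg, hint]

theorem ae_eq_zero_of_condExp_eq_zero (hm : m ≤ m0) (hY : AEStronglyMeasurable Y μ)
    (hY01 : ∀ᵐ ω ∂μ, Y ω ∈ Set.Icc (0 : ℝ) 1) : ∀ᵐ ω ∂μ, μ[Y|m] ω = 0 → Y ω = 0 := by
  have hi := integrable_of_mem_Icc hY hY01
  have hs : MeasurableSet[m] (μ[Y|m] ⁻¹' {0}) :=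
    stronglyMeasurable_condExp.measurable (measurableSet_singleton 0)
  have h1 := setIntegral_condExp hm hi hs
  have h2 : ∫ ω in μ[Y|m] ⁻¹' {0}, μ[Y|m] ω ∂μ = 0 := by
    rw [setIntegral_congr_fun (g := fun _ => (0 : ℝ)) (hm _ hs) (fun ω h => h)]; simp
  rw [h2] at h1
  have h3 := (setIntegral_eq_zero_iff_of_nonneg_ae
    (ae_restrict_of_ae (hY01.mono fun ω h => h.1)) hi.integrableOn).1 h1.symm
  exact (ae_restrict_iff' (hm _ hs)).1 h3

/-- The expected divergence from `Y` to its conditional expectation is the difference of the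
expected negative entropies. -/
theorem lintegral_klBregman_condExp (hm : m ≤ m0) (hY : AEStronglyMeasurable Y μ)
    (hY01 : ∀ᵐ ω ∂μ, Y ω ∈ Set.Icc (0 : ℝ) 1) (hX : X =ᵐ[μ] μ[Y|m]) :
    ∫⁻ ω, klBregman (Y ω) (X ω) ∂μ =
        ENNReal.ofReal (∫ ω, negEntropy (Y ω) ∂μ - ∫ ω, negEntropy (μ[Y|m] ω) ∂μ) ∧
      0 ≤ ∫ ω, negEntropy (Y ω) ∂μ - ∫ ω, negEntropy (μ[Y|m] ω) ∂μ := by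
  have hi := integrable_of_mem_Icc hY hY01
  have hX01 : ∀ᵐ ω ∂μ, X ω ∈ Set.Icc (0 : ℝ) 1 := by
    filter_upwards [hX, condExp_mem_Icc hm hY hY01] with ω h1 h2
    rwa [h1]
  have hXm : AEStronglyMeasurable X μ := aestronglyMeasurable_condExp.congr hX.symm
  have hY1 : AEStronglyMeasurable (fun ω => 1 - Y ω) μ := aestronglyMeasurable_const.sub hY
  have hY101 : ∀ᵐ ω ∂μ, 1 - Y ω ∈ Set.Icc (0 : ℝ) 1 :=
    hY01.mono fun ω h => ⟨sub_nonneg.2 h.2, by linarith [h.1]⟩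
  have hce : μ[fun ω => 1 - Y ω|m] =ᵐ[μ] fun ω => 1 - μ[Y|m] ω := by
    have := condExp_sub (integrable_const (1 : ℝ)) hi m
    rw [condExp_const hm] at this
    exact this
  have hX1 : (fun ω => 1 - X ω) =ᵐ[μ] μ[fun ω => 1 - Y ω|m] := by
    filter_upwards [hX, hce] with ω h1 h2
    rw [h1, h2]
  obtain ⟨i1, e1⟩ := integrable_mul_log_condExp hm hY hY01 hX
  obtain ⟨i2, e2⟩ := integrable_mul_log_condExp hm hY1 hY101 hX1
  have iY := integrable_negEntropy_comp hY hY01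
  have iX := integrable_negEntropy_comp hXm hX01
  have zero := ae_eq_zero_of_condExp_eq_zero hm hY hY01
  have one := ae_eq_zero_of_condExp_eq_zero hm hY1 hY101
  have iXlog : Integrable (fun ω => X ω * Real.log (X ω)) μ := by
    have := (integrable_mul_log_condExp (m := m0) le_rfl hXm hX01 (X := X) ?_).1
    · exact this
    · exact (condExp_of_aestronglyMeasurable' le_rfl hXm
        (integrable_of_mem_Icc hXm hX01)).symm
  have hX1m : AEStronglyMeasurable (fun ω => 1 - X ω) μ := aestronglyMeasurable_const.sub hXm
  have iXlog1 : Integrable (fun ω => (1 - X ω) * Real.log (1 - X ω)) μ := by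
    have hX101 : ∀ᵐ ω ∂μ, 1 - X ω ∈ Set.Icc (0 : ℝ) 1 :=
      hX01.mono fun ω h => ⟨sub_nonneg.2 h.2, by linarith [h.1]⟩
    exact (integrable_mul_log_condExp (m := m0) le_rfl hX1m hX101 (X := fun ω => 1 - X ω)
      (condExp_of_aestronglyMeasurable' le_rfl hX1m
        (integrable_of_mem_Icc hX1m hX101)).symm).1
  have i12 : Integrable
      (fun ω => Y ω * Real.log (X ω) + (1 - Y ω) * Real.log (1 - X ω)) μ := i1.add i2
  have hD : (fun ω => bernoulliKL (Y ω) (X ω)) = fun ω => negEntropy (Y ω) -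
      (Y ω * Real.log (X ω) + (1 - Y ω) * Real.log (1 - X ω)) := by
    funext ω; unfold bernoulliKL negEntropy; ring
  have iD : Integrable (fun ω => bernoulliKL (Y ω) (X ω)) μ := by
    rw [hD]; exact iY.sub i12
  have hint : ∫ ω, bernoulliKL (Y ω) (X ω) ∂μ =
      ∫ ω, negEntropy (Y ω) ∂μ - ∫ ω, negEntropy (μ[Y|m] ω) ∂μ := by
    have h5 : ∫ ω, negEntropy (μ[Y|m] ω) ∂μ = ∫ ω, negEntropy (X ω) ∂μ :=
      integral_congr_ae (hX.mono fun ω h => by simp only [h])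
    rw [hD, integral_sub iY i12, integral_add i1 i2, e1, e2, ← integral_add iXlog iXlog1,
      h5]
    rfl
  -- The value `∞` is almost surely not attained: where the conditional expectation is `0` or `1`,
  -- `Y` almost surely equals it.
  have hae : ∀ᵐ ω ∂μ, klBregman (Y ω) (X ω) = ENNReal.ofReal (bernoulliKL (Y ω) (X ω)) ∧
      0 ≤ bernoulliKL (Y ω) (X ω) := by
    filter_upwards [hX, hX1, hX01, hY01, zero, one, hce] with ω h1 h2 h3 h4 h5 h6 h7
    by_cases h : X ω ∈ Set.Ioo (0 : ℝ) 1
    · exact ⟨klBregman_of_mem_Ioo h, bernoulliKL_nonneg h4 h⟩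
    · rcases h3.1.eq_or_lt with h0 | h0
      · have : Y ω = 0 := h5 (by rw [← h1, ← h0])
        rw [← h0, this]
        exact ⟨klBregman_self_zero, by simp [bernoulliKL]⟩
      · have hone : X ω = 1 := by
          by_contra hne
          exact h ⟨h0, lt_of_le_of_ne h3.2 hne⟩
        have : 1 - Y ω = 0 := h6 (by rw [← h2, hone]; simp)
        have : Y ω = 1 := by linarith
        rw [hone, this]
        exact ⟨klBregman_self_one, by simp [bernoulliKL]⟩
  rw [← hint]
  have hnn : 0 ≤ᵐ[μ] fun ω => bernoulliKL (Y ω) (X ω) := hae.mono fun ω h => h.2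
  refine ⟨?_, integral_nonneg_of_ae hnn⟩
  rw [lintegral_congr_ae (hae.mono fun ω h => h.1), ofReal_integral_eq_lintegral_ofReal iD hnn]

end Loss

/-! ### Joining a σ-algebra with a discrete random variable -/

/-- A function that is measurable after adjoining a discrete variable `κ` is, on each level set of
`κ`, equal to a function that was measurable before. -/
theorem exists_eq_of_measurable_sup_comap {Ω ι β : Type*} {m : MeasurableSpace Ω}
    [MeasurableSpace ι] [MeasurableSpace β] [StandardBorelSpace β] [Nonempty β] {κ : Ω → ι}
    {f : Ω → β} (hf : Measurable[m ⊔ MeasurableSpace.comap κ inferInstance] f) :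
    ∃ F : ι → Ω → β, (∀ i, Measurable[m] (F i)) ∧ ∀ ω, f ω = F (κ ω) ω := by
  have e : MeasurableSpace.comap (fun ω => (id ω, κ ω)) (m.prod inferInstance) =
      m ⊔ MeasurableSpace.comap κ inferInstance := by
    rw [MeasurableSpace.comap_prodMk, MeasurableSpace.comap_id]
  rw [← e] at hf
  obtain ⟨g, hg, rfl⟩ := Measurable.exists_eq_measurable_comp hf
  exact ⟨fun i ω => g (ω, i), fun i => hg.comp measurable_prodMk_right, fun ω => rfl⟩

theorem measurable_apply_of_countable {Ω ι β : Type*} {m : MeasurableSpace Ω} [Countable ι]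
    [MeasurableSpace ι] [MeasurableSingletonClass ι] [MeasurableSpace β] {κ : Ω → ι}
    (hκ : Measurable κ) {F : ι → Ω → β} (hF : ∀ i, Measurable (F i)) :
    Measurable fun ω => F (κ ω) ω :=
  (measurable_from_prod_countable_left (f := fun q : Ω × ι => F q.2 q.1) hF).comp
    (measurable_id.prodMk hκ)

/-! ### Conditioning on an event -/

section Cond

variable {Ω : Type*} {m m' mA mB : MeasurableSpace Ω} {m0 : MeasurableSpace Ω} {μ : Measure Ω}
  {Y : Ω → ℝ}

theorem integral_cond {R : Set Ω} (f : Ω → ℝ) :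
    ∫ ω, f ω ∂μ[|R] = (μ.real R)⁻¹ * ∫ ω in R, f ω ∂μ := by
  rw [ProbabilityTheory.cond, integral_smul_measure, ENNReal.toReal_inv, smul_eq_mul]
  rfl

theorem setIntegral_cond {R s : Set Ω} (hs : MeasurableSet s) (f : Ω → ℝ) :
    ∫ ω in s, f ω ∂μ[|R] = (μ.real R)⁻¹ * ∫ ω in s ∩ R, f ω ∂μ := by
  rw [ProbabilityTheory.cond, Measure.restrict_smul, integral_smul_measure,
    Measure.restrict_restrict hs, ENNReal.toReal_inv, smul_eq_mul]
  rfl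

theorem MeasureTheory.Integrable.cond {R : Set Ω} (hR : μ R ≠ 0) {f : Ω → ℝ}
    (hf : Integrable f μ) : Integrable f μ[|R] :=
  hf.restrict.smul_measure (ENNReal.inv_ne_top.2 hR)

variable [IsProbabilityMeasure μ]

/-- If on the event `R` the σ-algebra `m'` carries no more information than `m`, then
`E[Y | m']` is, on `R`, the expectation given `m` under the conditioned measure. -/
theorem condExp_ae_eq_cond_condExp (hm : m ≤ m') (hm' : m' ≤ m0)
    {R : Set Ω} (hR : MeasurableSet[m'] R) (hR0 : μ R ≠ 0) (hY : Integrable Y μ)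
    (hf : ∀ f : Ω → ℝ, Measurable[m'] f →
      ∃ f₀ : Ω → ℝ, Measurable[m] f₀ ∧ ∀ ω ∈ R, f ω = f₀ ω) :
    μ[Y|m'] =ᵐ[μ[|R]] (μ[|R])[Y|m] := by
  have := cond_isProbabilityMeasure hR0
  obtain ⟨f₀, hf₀, hfR⟩ := hf (μ[Y|m']) stronglyMeasurable_condExp.measurable
  have hae : f₀ =ᵐ[μ[|R]] μ[Y|m'] :=
    (ae_cond_of_forall_mem (hm' _ hR) fun ω h => (hfR ω h).symm)
  refine hae.symm.trans ?_
  have hint : Integrable f₀ μ[|R] := (integrable_condExp.cond hR0).congr hae.symm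
  refine ae_eq_condExp_of_forall_setIntegral_eq (hm.trans hm') (hY.cond hR0)
    (fun s _ _ => hint.integrableOn) (fun s hs _ => ?_)
    hf₀.stronglyMeasurable.aestronglyMeasurable
  have hs0 := hm'  _ (hm _ hs)
  -- The event `R` need not lie in `m`, but `s ∩ R` lies in `m'`, where the defining property of
  -- `μ[Y|m']` applies.
  rw [setIntegral_congr_ae (g := μ[Y|m']) hs0 (hae.mono fun ω h _ => h),
    setIntegral_cond hs0, setIntegral_cond hs0, setIntegral_condExp hm' hY ((hm _ hs).inter hR)]

/-- The expectation of `G` at the conditional expectation of `Y`. -/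
def expNegEntropy (μ : Measure Ω) (Y : Ω → ℝ) (m : MeasurableSpace Ω) : ℝ :=
  ∫ ω, negEntropy (μ[Y|m] ω) ∂μ

theorem setIntegral_negEntropy_condExp (hm : m ≤ m') (hm' : m' ≤ m0)
    {R : Set Ω} (hR : MeasurableSet[m'] R) (hR0 : μ R ≠ 0) (hY : Integrable Y μ)
    (hf : ∀ f : Ω → ℝ, Measurable[m'] f →
      ∃ f₀ : Ω → ℝ, Measurable[m] f₀ ∧ ∀ ω ∈ R, f ω = f₀ ω) :
    ∫ ω in R, negEntropy (μ[Y|m'] ω) ∂μ = μ.real R * expNegEntropy μ[|R] Y m := by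
  have h := condExp_ae_eq_cond_condExp hm hm' hR hR0 hY hf
  have hpos : μ.real R ≠ 0 := (measureReal_ne_zero_iff).2 hR0
  have : expNegEntropy μ[|R] Y m = ∫ ω, negEntropy (μ[Y|m'] ω) ∂μ[|R] :=
    integral_congr_ae (h.mono fun ω h => by simp only [h])
  rw [this, integral_cond, ← mul_assoc, mul_inv_cancel₀ hpos, one_mul]

/-- The substitutes condition on all rectangles of positive probability, in terms of the expected
negative entropies. -/
def SubstitutesOnRectangles (μ : Measure Ω) (Y : Ω → ℝ) (mA mB : MeasurableSpace Ω) : Prop :=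
  ∀ E F : Set Ω, MeasurableSet[mA] E → MeasurableSet[mB] F → μ (E ∩ F) ≠ 0 →
    expNegEntropy μ[|E ∩ F] Y (mA ⊔ mB) + expNegEntropy μ[|E ∩ F] Y ⊥ ≤
      expNegEntropy μ[|E ∩ F] Y mA + expNegEntropy μ[|E ∩ F] Y mB

omit [IsProbabilityMeasure μ] in
theorem SubstitutesOnRectangles.symm
    (h : SubstitutesOnRectangles μ Y mA mB) : SubstitutesOnRectangles μ Y mB mA := by
  intro E F hE hF h0
  rw [Set.inter_comm] at h0 ⊢
  have := h F E hF hE h0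
  rw [sup_comm]
  linarith

/-- A discrete random variable all of whose level sets are rectangles. -/
def IsRectangular {ι : Type*} (mA mB : MeasurableSpace Ω) (P : Ω → ι) : Prop :=
  ∀ i, ∃ E F : Set Ω, MeasurableSet[mA] E ∧ MeasurableSet[mB] F ∧ P ⁻¹' {i} = E ∩ F

theorem IsRectangular.symm {ι : Type*} {P : Ω → ι}
    (h : IsRectangular mA mB P) : IsRectangular mB mA P := fun i => by
  obtain ⟨E, F, hE, hF, e⟩ := h i
  exact ⟨F, E, hF, hE, by rw [e, Set.inter_comm]⟩

theorem IsRectangular.measurable {ι : Type*} [Countable ι] [MeasurableSpace ι]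
    [MeasurableSingletonClass ι] {P : Ω → ι}
    (h : IsRectangular mA mB P) : Measurable[mA ⊔ mB] P := by
  refine @measurable_to_countable' ι Ω _ _ (mA ⊔ mB) P fun i => ?_
  obtain ⟨E, F, hE, hF, e⟩ := h i
  rw [e]
  exact MeasurableSet.inter ((le_sup_left : mA ≤ mA ⊔ mB) _ hE)
    ((le_sup_right : mB ≤ mA ⊔ mB) _ hF)

/-- Alice's messages refine rectangles to rectangles. -/
theorem IsRectangular.prodMk {ι κ : Type*} [MeasurableSpace ι]
    [MeasurableSpace κ] [MeasurableSingletonClass κ]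
    {P : Ω → ι} (h : IsRectangular mA mB P) {Z : Ω → κ}
    (hZ : Measurable[mA ⊔ MeasurableSpace.comap P inferInstance] Z) :
    IsRectangular mA mB fun ω => (P ω, Z ω) := by
  classical
  rintro ⟨i, j⟩
  obtain ⟨E, F, hE, hF, e⟩ := h i
  -- The event `Z = j` is encoded as a real function because the factorisation needs a standard
  -- Borel target, while `κ` is arbitrary. On the cell `P = i` it becomes an event of Alice, which
  -- only cuts the side `E`.
  have hf : Measurable[mA ⊔ MeasurableSpace.comap P inferInstance] fun ω =>
      (if Z ω = j then (1 : ℝ) else 0) :=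
    Measurable.ite (hZ (measurableSet_singleton j)) measurable_const measurable_const
  obtain ⟨g, hg, hgf⟩ := exists_eq_of_measurable_sup_comap hf
  refine ⟨E ∩ g i ⁻¹' {1}, F, hE.inter (hg i (measurableSet_singleton 1)), hF, ?_⟩
  ext ω
  have h1 : P ω = i ↔ ω ∈ E ∩ F := by rw [← e]; rfl
  have h2 := hgf ω
  simp only [Set.mem_preimage, Set.mem_singleton_iff, Prod.mk.injEq, Set.mem_inter_iff]
  constructor
  · rintro ⟨rfl, rfl⟩
    have := h1.1 rfl
    exact ⟨⟨this.1, by rw [← h2]; simp⟩, this.2⟩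
  · rintro ⟨⟨a, b⟩, c⟩
    have hP := h1.2 ⟨a, c⟩
    subst hP
    refine ⟨rfl, ?_⟩
    rw [b] at h2
    by_contra hne
    simp [hne] at h2

/-- Rectangle substitutes, summed over a countable partition into rectangles. -/
theorem SubstitutesOnRectangles.expNegEntropy_sup_add_le {ι : Type*} [Countable ι]
    [MeasurableSpace ι] [MeasurableSingletonClass ι] (hA : mA ≤ m0)
    (hB : mB ≤ m0) (hY : AEStronglyMeasurable Y μ) (hY01 : ∀ᵐ ω ∂μ, Y ω ∈ Set.Icc (0 : ℝ) 1)
    (h : SubstitutesOnRectangles μ Y mA mB) {P : Ω → ι} (hP : IsRectangular mA mB P) :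
    expNegEntropy μ Y (mA ⊔ mB) + expNegEntropy μ Y (MeasurableSpace.comap P inferInstance) ≤
      expNegEntropy μ Y (mA ⊔ MeasurableSpace.comap P inferInstance) +
      expNegEntropy μ Y (mB ⊔ MeasurableSpace.comap P inferInstance) := by
  have hi := integrable_of_mem_Icc hY hY01
  have hAB : mA ⊔ mB ≤ m0 := sup_le hA hB
  have hPm : Measurable P := hP.measurable.mono hAB le_rfl
  set mP : MeasurableSpace Ω := MeasurableSpace.comap P inferInstance with hmP
  have hP0 : mP ≤ m0 := hPm.comap_le
  have int : ∀ m : MeasurableSpace Ω, m ≤ m0 → Integrable (fun ω => negEntropy (μ[Y|m] ω)) μ :=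
    fun m hm => integrable_negEntropy_comp aestronglyMeasurable_condExp (condExp_mem_Icc hm hY hY01)
  have i1 := int _ hAB
  have i2 := int _ hP0
  have i3 := int _ (sup_le hA hP0)
  have i4 := int _ (sup_le hB hP0)
  set f : Ω → ℝ := fun ω => (negEntropy (μ[Y|mA ⊔ mB] ω) + negEntropy (μ[Y|mP] ω)) -
    (negEntropy (μ[Y|mA ⊔ mP] ω) + negEntropy (μ[Y|mB ⊔ mP] ω)) with hfdef
  have i12 : Integrable (fun ω => negEntropy (μ[Y|mA ⊔ mB] ω) + negEntropy (μ[Y|mP] ω)) μ :=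
    i1.add i2
  have i34 : Integrable
      (fun ω => negEntropy (μ[Y|mA ⊔ mP] ω) + negEntropy (μ[Y|mB ⊔ mP] ω)) μ := i3.add i4
  have ifm : Integrable f μ := i12.sub i34
  have key : ∀ i, ∫ ω in P ⁻¹' {i}, f ω ∂μ ≤ 0 := by
    intro i
    by_cases h0 : μ (P ⁻¹' {i}) = 0
    · rw [setIntegral_measure_zero _ h0]
    have hRP : MeasurableSet[mP] (P ⁻¹' {i}) := ⟨_, measurableSet_singleton i, rfl⟩
    -- On a cell the label `P` is constant, so adjoining it to `m` adds nothing there. In particular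
    -- `mP` itself becomes trivial, which produces the term with `⊥`.
    have agree : ∀ (m : MeasurableSpace Ω) (f : Ω → ℝ), Measurable[m ⊔ mP] f →
        ∃ f₀ : Ω → ℝ, Measurable[m] f₀ ∧ ∀ ω ∈ P ⁻¹' {i}, f ω = f₀ ω := by
      intro m f hf
      obtain ⟨F, hF, hfF⟩ := exists_eq_of_measurable_sup_comap hf
      exact ⟨F i, hF i, fun ω h => by rw [hfF ω, show P ω = i from h]⟩
    have e1 := setIntegral_negEntropy_condExp (le_refl (mA ⊔ mB)) hAB
      (hP.measurable (measurableSet_singleton i)) h0 hi (fun f hf => ⟨f, hf, fun _ _ => rfl⟩)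
    have e2 := setIntegral_negEntropy_condExp (m := ⊥) (m' := mP) bot_le hP0 hRP h0 hi
      (fun f hf => agree ⊥ f (by rwa [bot_sup_eq]))
    have e3 := setIntegral_negEntropy_condExp (m := mA) (m' := mA ⊔ mP) le_sup_left
      (sup_le hA hP0) ((le_sup_right : mP ≤ mA ⊔ mP) _ hRP) h0 hi (agree mA)
    have e4 := setIntegral_negEntropy_condExp (m := mB) (m' := mB ⊔ mP) le_sup_left
      (sup_le hB hP0) ((le_sup_right : mP ≤ mB ⊔ mP) _ hRP) h0 hi (agree mB)
    rw [hfdef, integral_sub i12.integrableOn i34.integrableOn,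
      integral_add i1.integrableOn i2.integrableOn, integral_add i3.integrableOn i4.integrableOn,
      e1, e2, e3, e4]
    obtain ⟨E, F, hE, hF, e⟩ := hP i
    have hs := h E F hE hF (by rwa [← e])
    rw [← e] at hs
    nlinarith [measureReal_nonneg (μ := μ) (s := P ⁻¹' {i})]
  have hsum : ∫ ω, f ω ∂μ ≤ 0 := by
    have hu : ⋃ i, P ⁻¹' {i} = Set.univ := by ext ω; simp
    have := integral_iUnion (μ := μ) (f := f) (s := fun i => P ⁻¹' {i})
      (fun i => hPm (measurableSet_singleton i))
      (fun i j hij => Disjoint.preimage P (by simpa using hij)) ifm.integrableOn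
    rw [hu, Measure.restrict_univ] at this
    rw [this]
    exact tsum_nonpos key
  rw [hfdef, integral_sub i12 i34, integral_add i1 i2, integral_add i3 i4] at hsum
  unfold expNegEntropy
  linarith

end Cond

/-! ### Information structures -/

namespace InfoStructure

variable {Ω S T : Type*} [m0 : MeasurableSpace Ω] [MeasurableSpace S] [MeasurableSpace T]
  (I : InfoStructure Ω S T)

/-- The information in Alice's signal. -/
abbrev aliceInfo : MeasurableSpace Ω := MeasurableSpace.comap I.σ inferInstance

/-- The information in Bob's signal. -/
abbrev bobInfo : MeasurableSpace Ω := MeasurableSpace.comap I.τ inferInstance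

theorem truth_eq : I.truth = I.P[I.Y|I.aliceInfo ⊔ I.bobInfo] := by
  rw [truth, ← MeasurableSpace.comap_prodMk]; rfl

/-- The term `E[G(Y)]` does not depend on `X`, so it cancels from the substitutes inequality. -/
theorem condLoss_eq {Ω S T : Type*} {m : MeasurableSpace Ω} [m0 : MeasurableSpace Ω]
    [MeasurableSpace S] [MeasurableSpace T] (I : InfoStructure Ω S T) {A : Set S} {B : Set T}
    (h0 : I.P (I.rect A B) ≠ 0) (hm : m ≤ m0) {X : Ω → ℝ}
    (hX : X =ᵐ[I.P[|I.rect A B]] (I.P[|I.rect A B])[I.Y|m]) :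
    I.condLoss A B X = ∫ ω, negEntropy (I.Y ω) ∂I.P[|I.rect A B] -
      expNegEntropy I.P[|I.rect A B] I.Y m := by
  have := cond_isProbabilityMeasure h0
  obtain ⟨h1, h2⟩ := lintegral_klBregman_condExp hm I.measurable_Y.aestronglyMeasurable
    (.of_forall I.Y_mem) hX
  rw [condLoss, h1, ENNReal.toReal_ofReal h2]
  rfl

theorem RectangleSubstitutes.substitutesOnRectangles (h : I.RectangleSubstitutes) :
    SubstitutesOnRectangles I.P I.Y I.aliceInfo I.bobInfo := by
  rintro _ _ ⟨A, hA, rfl⟩ ⟨B, hB, rfl⟩ h0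
  have hi : Integrable I.Y I.P :=
    integrable_of_mem_Icc I.measurable_Y.aestronglyMeasurable (.of_forall I.Y_mem)
  have hσ : I.aliceInfo ≤ m0 := I.measurable_σ.comap_le
  have hτ : I.bobInfo ≤ m0 := I.measurable_τ.comap_le
  have hA' : MeasurableSet[I.aliceInfo] (I.σ ⁻¹' A) := ⟨A, hA, rfl⟩
  have hB' : MeasurableSet[I.bobInfo] (I.τ ⁻¹' B) := ⟨B, hB, rfl⟩
  have hA0 : I.P (I.σ ⁻¹' A) ≠ 0 := fun h => h0 (measure_mono_null Set.inter_subset_left h)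
  have hB0 : I.P (I.τ ⁻¹' B) ≠ 0 := fun h => h0 (measure_mono_null Set.inter_subset_right h)
  have := cond_isProbabilityMeasure hA0
  have := cond_isProbabilityMeasure hB0
  have := cond_isProbabilityMeasure h0
  -- `muBob` and `muAlice` condition on one side of the rectangle only. Conditioning on the other
  -- side as well does not change them, since that side is an event of the party who predicts.
  have eAB : I.P[|I.σ ⁻¹' A][|I.τ ⁻¹' B] = I.P[|I.rect A B] :=
    cond_cond_eq_cond_inter (hσ _ hA') (hτ _ hB') I.P
  have eBA : I.P[|I.τ ⁻¹' B][|I.σ ⁻¹' A] = I.P[|I.rect A B] := by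
    rw [cond_cond_eq_cond_inter (hτ _ hB') (hσ _ hA') I.P, Set.inter_comm]; rfl
  have posAB : I.P[|I.σ ⁻¹' A] (I.τ ⁻¹' B) ≠ 0 :=
    (cond_pos_of_inter_ne_zero (hσ _ hA') h0).ne'
  have posBA : I.P[|I.τ ⁻¹' B] (I.σ ⁻¹' A) ≠ 0 :=
    (cond_pos_of_inter_ne_zero (hτ _ hB') (by rwa [Set.inter_comm])).ne'
  have triv : ∀ (m : MeasurableSpace Ω) (R : Set Ω) (f : Ω → ℝ), Measurable[m] f →
      ∃ f₀ : Ω → ℝ, Measurable[m] f₀ ∧ ∀ ω ∈ R, f ω = f₀ ω :=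
    fun m R f hf => ⟨f, hf, fun _ _ => rfl⟩
  have c1 : I.muBob A =ᵐ[I.P[|I.rect A B]] (I.P[|I.rect A B])[I.Y|I.bobInfo] := by
    rw [← eAB]
    exact condExp_ae_eq_cond_condExp le_rfl hτ hB' posAB (hi.cond hA0) (triv I.bobInfo _)
  have c2 : I.muAlice B =ᵐ[I.P[|I.rect A B]] (I.P[|I.rect A B])[I.Y|I.aliceInfo] := by
    rw [← eBA]
    exact condExp_ae_eq_cond_condExp le_rfl hσ hA' posBA (hi.cond hB0) (triv I.aliceInfo _)
  have c3 : I.truth =ᵐ[I.P[|I.rect A B]] (I.P[|I.rect A B])[I.Y|I.aliceInfo ⊔ I.bobInfo] := by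
    rw [truth_eq]
    exact condExp_ae_eq_cond_condExp le_rfl (sup_le hσ hτ)
      (((le_sup_left : I.aliceInfo ≤ I.aliceInfo ⊔ I.bobInfo) _ hA').inter
        ((le_sup_right : I.bobInfo ≤ I.aliceInfo ⊔ I.bobInfo) _ hB')) h0 hi
      (triv (I.aliceInfo ⊔ I.bobInfo) _)
  have c4 : (fun _ => I.muRect A B) =ᵐ[I.P[|I.rect A B]] (I.P[|I.rect A B])[I.Y|⊥] := by
    have : IsProbabilityMeasure I.P[|I.rect A B] := cond_isProbabilityMeasure h0
    rw [condExp_bot]; rfl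
  have hRS := h A B hA hB h0
  rw [I.condLoss_eq h0 hτ c1, I.condLoss_eq h0 hσ c2, I.condLoss_eq h0 (sup_le hσ hτ) c3,
    I.condLoss_eq h0 bot_le c4] at hRS
  change expNegEntropy I.P[|I.rect A B] I.Y (I.aliceInfo ⊔ I.bobInfo) +
    expNegEntropy I.P[|I.rect A B] I.Y ⊥ ≤
      expNegEntropy I.P[|I.rect A B] I.Y I.aliceInfo + expNegEntropy I.P[|I.rect A B] I.Y I.bobInfo
  linarith

end InfoStructure

/-! ### Random shifts of a grid -/

theorem intervalIntegral_fract_add (x y : ℝ) :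
    ∫ s in (0 : ℝ)..1, Int.fract (x + s) = ∫ s in (0 : ℝ)..1, Int.fract (y + s) := by
  have h : ∀ x : ℝ, ∫ s in (0 : ℝ)..1, Int.fract (x + s) = ∫ s in x..x + 1, Int.fract s := by
    intro x
    rw [intervalIntegral.integral_comp_add_left (fun s : ℝ => Int.fract s) x, add_zero]
  rw [h, h]
  exact (Int.fract_periodic ℝ).intervalIntegral_add_eq x y

/-- A grid of unit mesh with a uniformly random offset separates `x` and `y` with probability at
most `|x - y|`. -/
theorem volume_floor_add_ne_le (x y : ℝ) :
    (volume.restrict (Set.Ioc (0 : ℝ) 1)) {s | ⌊x + s⌋ ≠ ⌊y + s⌋} ≤ ENNReal.ofReal |x - y| := by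
  wlog hxy : x ≤ y generalizing x y
  · have := this y x (le_of_not_ge hxy)
    rw [abs_sub_comm]
    simpa only [ne_comm] using this
  have hint : ∀ x : ℝ, IntegrableOn (fun s => Int.fract (x + s)) (Set.Ioc (0 : ℝ) 1) := by
    intro x
    refine Integrable.of_bound
      (measurable_fract.comp (measurable_const_add x)).aestronglyMeasurable 1
      (.of_forall fun s => ?_)
    rw [Real.norm_eq_abs, abs_of_nonneg (Int.fract_nonneg _)]
    exact (Int.fract_lt_one _).le
  have hintd : IntegrableOn (fun s => Int.fract (y + s) - Int.fract (x + s)) (Set.Ioc (0 : ℝ) 1) :=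
    (hint y).sub (hint x)
  have hsplit : (fun s : ℝ => ((⌊y + s⌋ : ℝ) - ⌊x + s⌋)) =
      fun s => (y - x) - (Int.fract (y + s) - Int.fract (x + s)) := by
    funext s; simp only [Int.fract]; ring
  have hi : IntegrableOn (fun s : ℝ => ((⌊y + s⌋ : ℝ) - ⌊x + s⌋)) (Set.Ioc (0 : ℝ) 1) := by
    rw [hsplit]
    exact (integrable_const _).sub hintd
  -- Both fractional parts have the same mean over a period. The difference of the floors is thus a
  -- nonnegative integer of mean `y - x`, and it dominates the indicator of its being nonzero.
  have hval : ∫ s in Set.Ioc (0 : ℝ) 1, ((⌊y + s⌋ : ℝ) - ⌊x + s⌋) = y - x := by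
    have h := intervalIntegral_fract_add y x
    rw [intervalIntegral.integral_of_le zero_le_one,
      intervalIntegral.integral_of_le zero_le_one] at h
    rw [hsplit, integral_sub (integrable_const _) hintd,
      integral_sub (hint y) (hint x), h]
    simp
  have hmono : ∀ s : ℝ, (⌊x + s⌋ : ℝ) ≤ ⌊y + s⌋ := fun s =>
    Int.cast_le.2 (Int.floor_le_floor (by linarith))
  have hset : MeasurableSet {s : ℝ | ⌊x + s⌋ ≠ ⌊y + s⌋} :=
    (measurableSet_eq_fun (Int.measurable_floor.comp (measurable_const_add x))
      (Int.measurable_floor.comp (measurable_const_add y))).compl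
  rw [abs_sub_comm, abs_of_nonneg (sub_nonneg.2 hxy), ← hval,
    ofReal_integral_eq_lintegral_ofReal hi (.of_forall fun s => sub_nonneg.2 (hmono s)),
    ← lintegral_indicator_one hset]
  refine lintegral_mono fun s => ?_
  by_cases hs : ⌊x + s⌋ = ⌊y + s⌋
  · rw [Set.indicator_of_notMem (by simpa using hs)]; exact zero_le
  · rw [Set.indicator_of_mem (by simpa using hs), Pi.one_apply, ENNReal.one_le_ofReal]
    have h1 := lt_of_le_of_ne (Int.cast_le.1 (hmono s)) hs
    have h2 : ((⌊x + s⌋ + 1 : ℤ) : ℝ) ≤ (⌊y + s⌋ : ℝ) := Int.cast_le.2 h1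
    push_cast at h2
    linarith

/-- By Fubini the bound holds on average over uniform shifts, hence for some shift. -/
theorem exists_shift_measure_floor_ne_le {Ω : Type*} {m0 : MeasurableSpace Ω} {μ : Measure Ω}
    [IsProbabilityMeasure μ] {f g : Ω → ℝ} (hf : Measurable f) (hg : Measurable g) :
    ∃ s : ℝ, μ {ω | ⌊f ω + s⌋ ≠ ⌊g ω + s⌋} ≤ ∫⁻ ω, ENNReal.ofReal |f ω - g ω| ∂μ := by
  set ν : Measure ℝ := volume.restrict (Set.Ioc (0 : ℝ) 1) with hν
  have : IsProbabilityMeasure ν := ⟨by simp [hν]⟩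
  set D : Set (Ω × ℝ) := {q | ⌊f q.1 + q.2⌋ ≠ ⌊g q.1 + q.2⌋}
  have hD : MeasurableSet D :=
    (measurableSet_eq_fun
      (Int.measurable_floor.comp ((hf.comp measurable_fst).add measurable_snd))
      (Int.measurable_floor.comp ((hg.comp measurable_fst).add measurable_snd))).compl
  obtain ⟨s, hs⟩ := exists_le_lintegral (μ := ν)
    (f := fun s => μ ((fun ω => (ω, s)) ⁻¹' D)) (measurable_measure_prodMk_right hD).aemeasurable
  refine ⟨s, hs.trans ?_⟩
  rw [← Measure.prod_apply_symm hD, Measure.prod_apply hD]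
  exact lintegral_mono fun ω => volume_floor_add_ne_le (f ω) (g ω)

section Core

variable {Ω : Type*} {m m' mA mB : MeasurableSpace Ω} {m0 : MeasurableSpace Ω} {μ : Measure Ω}
  {Y : Ω → ℝ} [IsProbabilityMeasure μ]

/-! ### Comparing conditional expectations -/

/-- The conditional expectation given a coarser σ-algebra is almost as good as any approximation
that is measurable with respect to it. -/
theorem integral_abs_condExp_sub_condExp_le (hm : m ≤ m') (hm' : m' ≤ m0) {f₀ : Ω → ℝ}
    (hf₀ : StronglyMeasurable[m] f₀) (hfi : Integrable f₀ μ) :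
    ∫ ω, |μ[Y|m'] ω - μ[Y|m] ω| ∂μ ≤ 2 * ∫ ω, |μ[Y|m'] ω - f₀ ω| ∂μ := by
  have h1 : μ[μ[Y|m'] - f₀|m] =ᵐ[μ] μ[Y|m] - f₀ := by
    have := condExp_sub (μ := μ) (f := μ[Y|m']) integrable_condExp hfi m
    rw [condExp_of_stronglyMeasurable (hm.trans hm') hf₀ hfi] at this
    filter_upwards [this, condExp_condExp_of_le (μ := μ) (f := Y) hm hm'] with ω h2 h3
    rw [h2, Pi.sub_apply, Pi.sub_apply, h3]
  have h2 := integral_abs_condExp_le (μ := μ) (m := m) (μ[Y|m'] - f₀)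
  have h3 : ∫ ω, |μ[μ[Y|m'] - f₀|m] ω| ∂μ = ∫ ω, |μ[Y|m] ω - f₀ ω| ∂μ :=
    integral_congr_ae (h1.mono fun ω h => by simp only [h, Pi.sub_apply])
  rw [h3] at h2
  have i1 : Integrable (fun ω => |μ[Y|m'] ω - f₀ ω|) μ := (integrable_condExp.sub hfi).abs
  have i2 : Integrable (fun ω => |μ[Y|m] ω - f₀ ω|) μ := (integrable_condExp.sub hfi).abs
  have i3 : Integrable (fun ω => |μ[Y|m'] ω - μ[Y|m] ω|) μ :=
    (integrable_condExp.sub integrable_condExp).abs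
  calc ∫ ω, |μ[Y|m'] ω - μ[Y|m] ω| ∂μ
      ≤ ∫ ω, (|μ[Y|m'] ω - f₀ ω| + |μ[Y|m] ω - f₀ ω|) ∂μ := by
        refine integral_mono i3 (i1.add i2) fun ω => ?_
        have := abs_sub_le (μ[Y|m'] ω) (f₀ ω) (μ[Y|m] ω)
        rwa [abs_sub_comm (f₀ ω)] at this
    _ = ∫ ω, |μ[Y|m'] ω - f₀ ω| ∂μ + ∫ ω, |μ[Y|m] ω - f₀ ω| ∂μ := integral_add i1 i2
    _ ≤ _ := by simp only [Pi.sub_apply] at h2; linarith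

theorem integral_abs_sub_le_measureReal {f g : Ω → ℝ} {D : Set Ω}
    (hf : ∀ᵐ ω ∂μ, f ω ∈ Set.Icc (0 : ℝ) 1) (hg : ∀ᵐ ω ∂μ, g ω ∈ Set.Icc (0 : ℝ) 1)
    (hD : MeasurableSet D) (h : ∀ᵐ ω ∂μ, ω ∉ D → f ω = g ω) :
    ∫ ω, |f ω - g ω| ∂μ ≤ μ.real D := by
  rw [← integral_indicator_one hD]
  refine integral_mono_of_nonneg (.of_forall fun ω => abs_nonneg _)
    ((integrable_const 1).indicator hD) ?_
  filter_upwards [hf, hg, h] with ω h1 h2 h3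
  by_cases hω : ω ∈ D
  · rw [Set.indicator_of_mem hω, Pi.one_apply, abs_le]
    constructor <;> linarith [h1.1, h1.2, h2.1, h2.2]
  · rw [h3 hω, Set.indicator_of_notMem hω]; simp

/-- Adjoining a discrete variable that is almost known changes a conditional expectation little. -/
theorem integral_abs_condExp_sup_comap_sub_le {ι : Type*} [Countable ι] [MeasurableSpace ι]
    [MeasurableSingletonClass ι] (hm : m ≤ m0) (hY : AEStronglyMeasurable Y μ)
    (hY01 : ∀ᵐ ω ∂μ, Y ω ∈ Set.Icc (0 : ℝ) 1) {κ κ' : Ω → ι} (hκ : Measurable κ)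
    (hκ' : Measurable[m] κ') :
    ∫ ω, |μ[Y|m ⊔ MeasurableSpace.comap κ inferInstance] ω - μ[Y|m] ω| ∂μ ≤
      2 * μ.real {ω | κ ω ≠ κ' ω} := by
  set m' : MeasurableSpace Ω := m ⊔ MeasurableSpace.comap κ inferInstance
  have hm' : m' ≤ m0 := sup_le hm hκ.comap_le
  obtain ⟨F, hF, hfF⟩ := exists_eq_of_measurable_sup_comap
    (stronglyMeasurable_condExp (μ := μ) (f := Y) (m := m')).measurable
  -- The representation of the finer expectation is evaluated at the guess `κ'` instead of `κ`.
  -- Where the guess fails, `F` may leave `[0, 1]`; clamping keeps the error there at most `1`.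
  have hf₀ : Measurable[m] fun ω => max 0 (min 1 (F (κ' ω) ω)) :=
    measurable_const.max (measurable_const.min (measurable_apply_of_countable hκ' hF))
  have h01 : ∀ ω, max 0 (min 1 (F (κ' ω) ω)) ∈ Set.Icc (0 : ℝ) 1 := fun ω =>
    ⟨le_max_left _ _, max_le zero_le_one (min_le_left _ _)⟩
  have hb := condExp_mem_Icc hm' hY hY01
  refine (integral_abs_condExp_sub_condExp_le le_sup_left hm' hf₀.stronglyMeasurable
    (integrable_of_mem_Icc (hf₀.mono hm le_rfl).aestronglyMeasurable (.of_forall h01))).trans ?_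
  have hD : MeasurableSet[m0] {ω | κ ω ≠ κ' ω} :=
    (measurableSet_eq_fun hκ (hκ'.mono hm le_rfl)).compl
  have := integral_abs_sub_le_measureReal hb (.of_forall h01) hD (hb.mono fun ω h h2 => by
    have h3 : κ ω = κ' ω := by simpa using h2
    rw [← h3, ← hfF ω, min_eq_right h.2, max_eq_right h.1])
  linarith

theorem abs_integral_negEntropy_sub_le {f g : Ω → ℝ} (hfm : AEStronglyMeasurable f μ)
    (hgm : AEStronglyMeasurable g μ) (hf : ∀ᵐ ω ∂μ, f ω ∈ Set.Icc (0 : ℝ) 1)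
    (hg : ∀ᵐ ω ∂μ, g ω ∈ Set.Icc (0 : ℝ) 1) {l : ℝ} (hl : 0 < l) (hl1 : l ≤ 1) :
    |∫ ω, negEntropy (f ω) ∂μ - ∫ ω, negEntropy (g ω) ∂μ| ≤
      2 * ((∫ ω, |f ω - g ω| ∂μ) * (1 + Real.log (1 / l)) + l) := by
  have i1 := integrable_negEntropy_comp hfm hf
  have i2 := integrable_negEntropy_comp hgm hg
  have i3 : Integrable (fun ω => |f ω - g ω|) μ :=
    ((integrable_of_mem_Icc hfm hf).sub (integrable_of_mem_Icc hgm hg)).abs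
  have i4 : Integrable (fun ω => |f ω - g ω| * (1 + Real.log (1 / l))) μ := i3.mul_const _
  rw [← integral_sub i1 i2]
  refine abs_integral_le_integral_abs.trans ?_
  calc ∫ ω, |negEntropy (f ω) - negEntropy (g ω)| ∂μ
      ≤ ∫ ω, 2 * (|f ω - g ω| * (1 + Real.log (1 / l)) + l) ∂μ := by
        refine integral_mono_ae (i1.sub i2).abs ((i4.add (integrable_const l)).const_mul 2) ?_
        filter_upwards [hf, hg] with ω h1 h2 using abs_negEntropy_sub_le h1 h2 hl hl1
    _ = _ := by
        rw [integral_const_mul, integral_add i4 (integrable_const l), integral_mul_const]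
        simp

/-- The gap between the expected negative entropies given `m'` and given `m` is at most the
expected divergence to any `m`-measurable prediction. -/
theorem expNegEntropy_sub_le (hm : m ≤ m') (hm' : m' ≤ m0) (hY : AEStronglyMeasurable Y μ)
    (hY01 : ∀ᵐ ω ∂μ, Y ω ∈ Set.Icc (0 : ℝ) 1) {x : Ω → ℝ} (hx : Measurable[m] x) {u d : ℝ}
    (hu : 0 < u) (hxu : ∀ ω, x ω ∈ Set.Icc u (1 - u))
    (hd : ∀ᵐ ω ∂μ, bernoulliKL (μ[Y|m'] ω) (x ω) ≤ d) :
    expNegEntropy μ Y m' - expNegEntropy μ Y m ≤ d := by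
  have hi := integrable_of_mem_Icc hY hY01
  set L : Ω → ℝ := fun ω => Real.log (x ω) - Real.log (1 - x ω) with hL
  have hLm : Measurable[m] L :=
    (Real.measurable_log.comp hx).sub (Real.measurable_log.comp (measurable_const.sub hx))
  have hLb : ∀ ω, ‖L ω‖ ≤ -Real.log u := by
    intro ω
    obtain ⟨h1, h2⟩ := hxu ω
    have a1 := Real.log_le_log hu h1
    have a2 := Real.log_le_log hu (show u ≤ 1 - x ω by linarith)
    have a3 : Real.log (x ω) ≤ 0 := Real.log_nonpos (by linarith) (by linarith)
    have a4 : Real.log (1 - x ω) ≤ 0 := Real.log_nonpos (by linarith) (by linarith)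
    rw [Real.norm_eq_abs, abs_le]
    constructor <;> simp only [hL] <;> linarith
  -- `L` is `G'` at the prediction `x`. Being bounded and `m`-measurable, it has the same
  -- correlation with both expectations, so the linear terms of the two Bregman divergences cancel
  -- in the mean.
  have pull : ∀ k : MeasurableSpace Ω, m ≤ k → k ≤ m0 →
      Integrable (fun ω => L ω * μ[Y|k] ω) μ ∧
      ∫ ω, L ω * μ[Y|k] ω ∂μ = ∫ ω, L ω * Y ω ∂μ := by
    intro k hk hk0
    have h := condExp_stronglyMeasurable_mul_of_bound (μ := μ) hk0
      (hLm.mono hk le_rfl).stronglyMeasurable hi (-Real.log u) (.of_forall hLb)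
    have h' : μ[L * Y|k] =ᵐ[μ] fun ω => L ω * μ[Y|k] ω := h
    refine ⟨integrable_condExp.congr h', ?_⟩
    rw [← integral_congr_ae h', integral_condExp hk0]
    rfl
  obtain ⟨j1, e1⟩ := pull m le_rfl (hm.trans hm')
  obtain ⟨j2, e2⟩ := pull m' hm hm'
  have ha := condExp_mem_Icc hm' hY hY01
  have hc := condExp_mem_Icc (hm.trans hm') hY hY01
  have i1 := integrable_negEntropy_comp aestronglyMeasurable_condExp ha
  have i2 := integrable_negEntropy_comp aestronglyMeasurable_condExp hc
  have j21 : Integrable (fun ω => L ω * μ[Y|m'] ω - L ω * μ[Y|m] ω) μ := j2.sub j1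
  unfold expNegEntropy
  rw [← integral_sub i1 i2]
  calc ∫ ω, (negEntropy (μ[Y|m'] ω) - negEntropy (μ[Y|m] ω)) ∂μ
      ≤ ∫ ω, ((L ω * μ[Y|m'] ω - L ω * μ[Y|m] ω) + d) ∂μ := by
        refine integral_mono_ae (i1.sub i2) (j21.add (integrable_const d)) ?_
        filter_upwards [hc, hd] with ω h1 h2
        obtain ⟨h3, h4⟩ := hxu ω
        have h5 := bernoulliKL_nonneg h1 (x := x ω) ⟨by linarith, by linarith⟩
        rw [bernoulliKL_eq] at h2 h5
        simp only [hL]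
        nlinarith
    _ = d := by
        rw [integral_add j21 (integrable_const d), integral_sub j2 j1, e1, e2]
        simp

/-- Cauchy-Schwarz in the pointwise form `t ≤ (t² + r²) / (2r)` with `r = √(8δ)`, where `t²` is at
most `8` times the Jensen-Bregman divergence. -/
theorem integral_abs_hellingerCoord_sub_le {a b : Ω → ℝ} (ham : AEStronglyMeasurable a μ)
    (hbm : AEStronglyMeasurable b μ) (ha : ∀ᵐ ω ∂μ, a ω ∈ Set.Icc (0 : ℝ) 1)
    (hb : ∀ᵐ ω ∂μ, b ω ∈ Set.Icc (0 : ℝ) 1) {δ : ℝ} (hδ : 0 < δ)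
    (h : ∫ ω, jensenBregman (a ω) (b ω) ∂μ ≤ δ) :
    ∫⁻ ω, ENNReal.ofReal |hellingerCoord (a ω) - hellingerCoord (b ω)| ∂μ ≤
      ENNReal.ofReal √(8 * δ) := by
  set r := √(8 * δ) with hr
  have hr0 : 0 < r := Real.sqrt_pos.2 (by positivity)
  have hr2 : r ^ 2 = 8 * δ := Real.sq_sqrt (by positivity)
  have hθ : ∀ x : ℝ, x ∈ Set.Icc (0 : ℝ) 1 → |hellingerCoord x| ≤ 1 := by
    intro x hx
    have h1 : √x ≤ 1 := Real.sqrt_le_one.2 hx.2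
    have h2 : √(1 - x) ≤ 1 := Real.sqrt_le_one.2 (by linarith [hx.1])
    unfold hellingerCoord
    rw [abs_le]
    constructor <;> linarith [Real.sqrt_nonneg x, Real.sqrt_nonneg (1 - x)]
  have iJ : Integrable (fun ω => jensenBregman (a ω) (b ω)) μ := by
    unfold jensenBregman
    refine (((integrable_negEntropy_comp ham ha).add
      (integrable_negEntropy_comp hbm hb)).div_const 2).sub
      (integrable_negEntropy_comp (X := fun ω => (a ω + b ω) / 2) ?_ ?_)
    · refine ((ham.add hbm).mul_const (2 : ℝ)⁻¹).congr (.of_forall fun ω => ?_)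
      simp only [Pi.add_apply, div_eq_mul_inv]
    · filter_upwards [ha, hb] with ω h1 h2
      constructor <;> linarith [h1.1, h1.2, h2.1, h2.2]
  have iT : ∀ {f : Ω → ℝ}, AEStronglyMeasurable f μ → (∀ᵐ ω ∂μ, f ω ∈ Set.Icc (0 : ℝ) 1) →
      Integrable (fun ω => hellingerCoord (f ω)) μ := fun hf h =>
    Integrable.of_bound (continuous_hellingerCoord.comp_aestronglyMeasurable hf) 1
      (h.mono fun ω h => hθ _ h)
  have iA : Integrable (fun ω => |hellingerCoord (a ω) - hellingerCoord (b ω)|) μ :=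
    ((iT ham ha).sub (iT hbm hb)).abs
  rw [← ofReal_integral_eq_lintegral_ofReal iA (.of_forall fun ω => abs_nonneg _)]
  refine ENNReal.ofReal_le_ofReal ?_
  calc ∫ ω, |hellingerCoord (a ω) - hellingerCoord (b ω)| ∂μ
      ≤ ∫ ω, (jensenBregman (a ω) (b ω) * (4 / r) + r / 2) ∂μ := by
        refine integral_mono_ae iA ((iJ.mul_const _).add (integrable_const _)) ?_
        filter_upwards [ha, hb] with ω h1 h2
        have h3 := sq_hellingerCoord_sub_le h1 h2
        rw [← sq_abs] at h3
        set t := |hellingerCoord (a ω) - hellingerCoord (b ω)|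
        have h4 : jensenBregman (a ω) (b ω) * (4 / r) + r / 2 =
            (8 * jensenBregman (a ω) (b ω) + r ^ 2) / (2 * r) := by field_simp; ring
        rw [h4, le_div_iff₀ (by positivity)]
        nlinarith [sq_nonneg (t - r)]
    _ = (∫ ω, jensenBregman (a ω) (b ω) ∂μ) * (4 / r) + r / 2 := by
        rw [integral_add (iJ.mul_const _) (integrable_const _), integral_mul_const]; simp
    _ ≤ δ * (4 / r) + r / 2 := by gcongr
    _ = r := by
        have : δ = r ^ 2 / 8 := by linarith
        rw [this]; field_simp; ring

/-! ### Agreement implies accuracy for discrete transcripts -/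

/-- The heart of the argument. The term `128 w²` is what Alice's expectation still holds beyond its
bin; the other term bounds what the bin is worth to Bob. -/
theorem SubstitutesOnRectangles.expNegEntropy_sub_le {ι : Type*} [Countable ι]
    [MeasurableSpace ι] [MeasurableSingletonClass ι] (hA : mA ≤ m0) (hB : mB ≤ m0)
    (hY : AEStronglyMeasurable Y μ) (hY01 : ∀ᵐ ω ∂μ, Y ω ∈ Set.Icc (0 : ℝ) 1)
    (h : SubstitutesOnRectangles μ Y mA mB) {P : Ω → ι} (hP : IsRectangular mA mB P)
    {w l δ : ℝ} (hw : 0 < w) (hw2 : w ≤ 1 / 2) (hl : 0 < l) (hl1 : l ≤ 1) (hδ : 0 < δ)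
    (hJB : ∫ ω, jensenBregman (μ[Y|mA ⊔ MeasurableSpace.comap P inferInstance] ω)
      (μ[Y|mB ⊔ MeasurableSpace.comap P inferInstance] ω) ∂μ ≤ δ) :
    expNegEntropy μ Y (mA ⊔ mB) -
        expNegEntropy μ Y (mB ⊔ MeasurableSpace.comap P inferInstance) ≤
      128 * w ^ 2 + 2 * (2 * (√(8 * δ) / w) * (1 + Real.log (1 / l)) + l) := by
  classical
  have hPm : Measurable P := hP.measurable.mono (sup_le hA hB) le_rfl
  have hP0 : MeasurableSpace.comap P inferInstance ≤ m0 := hPm.comap_le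
  have hAP : mA ⊔ MeasurableSpace.comap P inferInstance ≤ m0 := sup_le hA hP0
  have hBP : mB ⊔ MeasurableSpace.comap P inferInstance ≤ m0 := sup_le hB hP0
  set a := μ[Y|mA ⊔ MeasurableSpace.comap P inferInstance] with ha
  set b := μ[Y|mB ⊔ MeasurableSpace.comap P inferInstance] with hb
  have ha01 : ∀ᵐ ω ∂μ, a ω ∈ Set.Icc (0 : ℝ) 1 := condExp_mem_Icc hAP hY hY01
  have hb01 : ∀ᵐ ω ∂μ, b ω ∈ Set.Icc (0 : ℝ) 1 := condExp_mem_Icc hBP hY hY01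
  have ham : Measurable[mA ⊔ MeasurableSpace.comap P inferInstance] a :=
    stronglyMeasurable_condExp.measurable
  have hbm : Measurable[mB ⊔ MeasurableSpace.comap P inferInstance] b :=
    stronglyMeasurable_condExp.measurable
  have hθ := integral_abs_hellingerCoord_sub_le aestronglyMeasurable_condExp
    aestronglyMeasurable_condExp ha01 hb01 hδ hJB
  have hcoord : Measurable fun y : ℝ => hellingerCoord y / w :=
    continuous_hellingerCoord.measurable.div_const w
  obtain ⟨s, hs⟩ := exists_shift_measure_floor_ne_le (μ := μ)
    (hcoord.comp (ham.mono hAP le_rfl)) (hcoord.comp (hbm.mono hBP le_rfl))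
  let bin : ℝ → ℤ := fun y => ⌊hellingerCoord y / w + s⌋
  have hbin : Measurable bin := Int.measurable_floor.comp (hcoord.add_const s)
  have hη : μ.real {ω | bin (a ω) ≠ bin (b ω)} ≤ √(8 * δ) / w := by
    have h1 : ∫⁻ ω, ENNReal.ofReal |hellingerCoord (a ω) / w - hellingerCoord (b ω) / w| ∂μ ≤
        ENNReal.ofReal (√(8 * δ) / w) := by
      have e : ∀ ω, ENNReal.ofReal |hellingerCoord (a ω) / w - hellingerCoord (b ω) / w| =
          ENNReal.ofReal |hellingerCoord (a ω) - hellingerCoord (b ω)| * ENNReal.ofReal w⁻¹ := by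
        intro ω
        rw [← ENNReal.ofReal_mul (abs_nonneg _), ← sub_div, abs_div, abs_of_pos hw,
          div_eq_mul_inv]
      simp_rw [e]
      rw [lintegral_mul_const' _ _ ENNReal.ofReal_ne_top, div_eq_mul_inv,
        ENNReal.ofReal_mul (Real.sqrt_nonneg _)]
      gcongr
    have h2 := ENNReal.toReal_mono ENNReal.ofReal_ne_top (hs.trans h1)
    rwa [ENNReal.toReal_ofReal (by positivity)] at h2
  -- a centre for each bin
  have hcentre : ∀ k : ℤ, ∃ x ∈ Set.Icc (w ^ 2) (1 - w ^ 2), ∀ y ∈ Set.Icc (0 : ℝ) 1,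
      bin y = k → bernoulliKL y x ≤ 128 * w ^ 2 := by
    intro k
    by_cases hk : ∃ y ∈ Set.Icc (0 : ℝ) 1, bin y = k
    · obtain ⟨y₀, hy₀, rfl⟩ := hk
      obtain ⟨x, hx, hxa⟩ := exists_bernoulliKL_le hy₀ hw hw2
      refine ⟨x, hx, fun y hy hyk => hxa y hy ?_⟩
      have h1 := Int.abs_sub_lt_one_of_floor_eq_floor hyk
      rw [add_sub_add_right_eq_sub, ← sub_div, abs_div, abs_of_pos hw, div_lt_one hw] at h1
      exact h1.le
    · push Not at hk
      exact ⟨1 / 2, ⟨by nlinarith, by nlinarith⟩, fun y hy hyk => absurd hyk (hk y hy)⟩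
  choose x hx hxk using hcentre
  have hκA : Measurable[mA ⊔ MeasurableSpace.comap P inferInstance] fun ω => bin (a ω) :=
    hbin.comp ham
  have hκB : Measurable[mB ⊔ MeasurableSpace.comap P inferInstance] fun ω => bin (b ω) :=
    hbin.comp hbm
  have hκ : Measurable fun ω => bin (a ω) := hκA.mono hAP le_rfl
  -- The bin of `a` is a legitimate message of Alice, so the refined partition still consists of
  -- rectangles. It tells Alice nothing new and drops out of her side below.
  have hsub := h.expNegEntropy_sup_add_le hA hB hY hY01 (hP.prodMk hκA)
  have hcomap : MeasurableSpace.comap (fun ω => (P ω, bin (a ω))) inferInstance =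
      MeasurableSpace.comap P inferInstance ⊔
        MeasurableSpace.comap (fun ω => bin (a ω)) inferInstance := by
    rw [← MeasurableSpace.comap_prodMk]; rfl
  rw [hcomap, ← sup_assoc, ← sup_assoc, sup_eq_left.2 hκA.comap_le] at hsub
  have hA' : expNegEntropy μ Y (mA ⊔ MeasurableSpace.comap P inferInstance) -
      expNegEntropy μ Y (MeasurableSpace.comap P inferInstance ⊔
        MeasurableSpace.comap (fun ω => bin (a ω)) inferInstance) ≤ 128 * w ^ 2 := by
    refine _root_.expNegEntropy_sub_le (x := fun ω => x (bin (a ω))) (u := w ^ 2)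
      (sup_le le_sup_right hκA.comap_le) hAP hY hY01 ?_ (by positivity) (fun ω => hx _)
      (ha01.mono fun ω h => hxk _ _ h rfl)
    exact (measurable_of_countable x).comp
      ((comap_measurable fun ω => bin (a ω)).mono le_sup_right le_rfl)
  have hB' := abs_integral_negEntropy_sub_le (μ := μ) aestronglyMeasurable_condExp
    aestronglyMeasurable_condExp
    (condExp_mem_Icc (sup_le hBP hκ.comap_le) hY hY01) hb01 hl hl1
  -- Bob's guess for the bin of `a` is the bin of `b`.
  have hdist := integral_abs_condExp_sup_comap_sub_le hBP hY hY01 hκ hκB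
  have hlog : 0 ≤ Real.log (1 / l) := Real.log_nonneg (by rw [le_div_iff₀ hl]; linarith)
  have hB'' := (abs_le.1 hB').2
  unfold expNegEntropy at hsub hA' ⊢
  have hmul := mul_le_mul_of_nonneg_right (hdist.trans (mul_le_mul_of_nonneg_left hη zero_le_two))
    (show 0 ≤ 1 + Real.log (1 / l) by linarith)
  linarith

end Core

/-! ### Agreement up to a small event -/

section Agree

variable {Ω α β : Type*} {m0 : MeasurableSpace Ω} {μ : Measure Ω}

theorem measure_ne_triangle (f g h : Ω → α) :
    μ {ω | f ω ≠ h ω} ≤ μ {ω | f ω ≠ g ω} + μ {ω | g ω ≠ h ω} := by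
  refine (measure_mono fun ω hω => ?_).trans (measure_union_le _ _)
  by_contra hc
  simp only [Set.mem_union, Set.mem_ofPred_eq, not_or, not_not] at hc
  exact hω (hc.1.trans hc.2)

theorem measure_comp_ne_le (φ : α → β) (f g : Ω → α) :
    μ {ω | φ (f ω) ≠ φ (g ω)} ≤ μ {ω | f ω ≠ g ω} :=
  measure_mono fun _ hω h => hω (congrArg φ h)

theorem measure_comp₂_ne_le {α' : Type*} (φ : α → α' → β) (f g : Ω → α) (f' g' : Ω → α') :
    μ {ω | φ (f ω) (f' ω) ≠ φ (g ω) (g' ω)} ≤ μ {ω | f ω ≠ g ω} + μ {ω | f' ω ≠ g' ω} := by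
  refine (measure_mono fun ω hω => ?_).trans (measure_union_le _ _)
  by_contra hc
  simp only [Set.mem_union, Set.mem_ofPred_eq, not_or, not_not] at hc
  exact hω (by simp only [hc.1, hc.2])

/-- Continuity from above: the events of disagreement at some time after `N` decrease to a null set.
-/
theorem exists_measure_ne_le [IsFiniteMeasure μ] {X : Ω → ℕ} {X' : ℕ → Ω → ℕ} (hX : Measurable X)
    (hX' : ∀ n, Measurable (X' n)) (h : ∀ᵐ ω ∂μ, ∃ N, ∀ n ≥ N, X ω = X' n ω) {δ : ℝ≥0∞}
    (hδ : δ ≠ 0) : ∃ n, μ {ω | X ω ≠ X' n ω} ≤ δ := by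
  let B : ℕ → Set Ω := fun N => ⋃ n ≥ N, {ω | X ω ≠ X' n ω}
  have hB : ∀ N, MeasurableSet (B N) := fun N =>
    .iUnion fun n => .iUnion fun _ => (measurableSet_eq_fun hX (hX' n)).compl
  have hanti : Antitone B := fun N M hNM =>
    Set.biUnion_subset_biUnion_left fun n (hn : M ≤ n) => hNM.trans hn
  have hlim := tendsto_measure_iInter_atTop (μ := μ) (fun N => (hB N).nullMeasurableSet) hanti
    ⟨0, measure_ne_top _ _⟩
  have h0 : μ (⋂ N, B N) = 0 := by
    have hsub : ⋂ N, B N ⊆ {ω | ¬∃ N, ∀ n ≥ N, X ω = X' n ω} := ?_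
    · exact measure_mono_null hsub (ae_iff.1 h)
    rintro ω hω ⟨N, hN⟩
    have := Set.mem_iInter.1 hω N
    simp only [B, Set.mem_iUnion] at this
    obtain ⟨n, hn, hne⟩ := this
    exact hne (hN n hn)
  rw [h0] at hlim
  obtain ⟨N, hN⟩ := (hlim.eventually_lt_const (pos_iff_ne_zero.2 hδ)).exists
  exact ⟨N, (measure_mono (Set.subset_biUnion_of_mem (u := fun n => {ω | X ω ≠ X' n ω})
    (le_refl N))).trans hN.le⟩

end Agree

/-! ### Approximation by pairs of discrete variables -/

section Approx

variable {Ω : Type*} {m m₁ m₂ mA mB g : MeasurableSpace Ω} {m0 : MeasurableSpace Ω}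
  {μ : Measure Ω}

/-- `X` agrees, up to events of small probability, with functions of an `m₁`-measurable and an
`m₂`-measurable discrete variable. -/
def PairApproximable (μ : Measure Ω) (m₁ m₂ : MeasurableSpace Ω) (X : Ω → ℕ) : Prop :=
  ∀ δ : ℝ≥0∞, δ ≠ 0 → ∃ (X₁ X₂ : Ω → ℕ) (h : ℕ → ℕ → ℕ), Measurable[m₁] X₁ ∧ Measurable[m₂] X₂ ∧
    μ {ω | X ω ≠ h (X₁ ω) (X₂ ω)} ≤ δ

theorem PairApproximable.map₂ {X X' : Ω → ℕ} (hX : PairApproximable μ m₁ m₂ X)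
    (hX' : PairApproximable μ m₁ m₂ X') (φ : ℕ → ℕ → ℕ) :
    PairApproximable μ m₁ m₂ fun ω => φ (X ω) (X' ω) := by
  intro δ hδ
  obtain ⟨X₁, X₂, h, h1, h2, h3⟩ := hX (δ / 2) (ENNReal.half_pos hδ).ne'
  obtain ⟨X₁', X₂', h', h1', h2', h3'⟩ := hX' (δ / 2) (ENNReal.half_pos hδ).ne'
  refine ⟨fun ω => Nat.pair (X₁ ω) (X₁' ω), fun ω => Nat.pair (X₂ ω) (X₂' ω),
    fun p q => φ (h p.unpair.1 q.unpair.1) (h' p.unpair.2 q.unpair.2),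
    (measurable_of_countable (Function.uncurry Nat.pair)).comp (h1.prodMk h1'),
    (measurable_of_countable (Function.uncurry Nat.pair)).comp (h2.prodMk h2'), ?_⟩
  simp only [Nat.unpair_pair]
  refine (measure_comp₂_ne_le φ _ _ _ _).trans ((add_le_add h3 h3').trans ?_)
  rw [ENNReal.add_halves]

theorem PairApproximable.of_eventually_eq [IsFiniteMeasure μ] {X : Ω → ℕ} {X' : ℕ → Ω → ℕ}
    (hX : Measurable X) (hX' : ∀ n, Measurable (X' n)) (h : ∀ ω, ∃ N, ∀ n ≥ N, X ω = X' n ω)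
    (ha : ∀ n, PairApproximable μ m₁ m₂ (X' n)) : PairApproximable μ m₁ m₂ X := by
  intro δ hδ
  obtain ⟨n, hn⟩ := exists_measure_ne_le (μ := μ) hX hX' (.of_forall h) (ENNReal.half_pos hδ).ne'
  obtain ⟨X₁, X₂, φ, h1, h2, h3⟩ := ha n (δ / 2) (ENNReal.half_pos hδ).ne'
  refine ⟨X₁, X₂, φ, h1, h2, (measure_ne_triangle _ (X' n) _).trans ((add_le_add hn h3).trans ?_)⟩
  rw [ENNReal.add_halves]

theorem PairApproximable.of_left {X : Ω → ℕ} (hX : Measurable[m₁] X) :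
    PairApproximable μ m₁ m₂ X := fun δ _ =>
  ⟨X, fun _ => 0, fun p _ => p, hX, measurable_const, by simp⟩

theorem PairApproximable.of_right {X : Ω → ℕ} (hX : Measurable[m₂] X) :
    PairApproximable μ m₁ m₂ X := fun δ _ =>
  ⟨fun _ => 0, X, fun _ q => q, measurable_const, hX, by simp⟩

open Classical in
-- Induction over the generation of `m₁ ⊔ m₂`. Approximable sets are closed under complements and
-- finite unions, and a countable union agrees with a finite one up to small measure.
theorem pairApproximable_indicator [IsFiniteMeasure μ] (h₁ : m₁ ≤ m0) (h₂ : m₂ ≤ m0) {s : Set Ω}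
    (hs : MeasurableSet[m₁ ⊔ m₂] s) :
    PairApproximable μ m₁ m₂ fun ω => if ω ∈ s then 1 else 0 := by
  have hle : m₁ ⊔ m₂ ≤ m0 := sup_le h₁ h₂
  have hmeas : ∀ (k : MeasurableSpace Ω) {s : Set Ω}, MeasurableSet[k] s →
      Measurable[k] fun ω => if ω ∈ s then (1 : ℕ) else 0 := fun k s hs =>
    Measurable.ite hs measurable_const measurable_const
  have hs' := MeasurableSpace.measurableSet_sup.1 hs
  clear hs
  induction hs' with
  | basic u hu =>
    rcases hu with hu | hu
    · exact .of_left (hmeas _ hu)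
    · exact .of_right (hmeas _ hu)
  | empty => exact .of_left (by simp)
  | compl t ht ih =>
    have := ih.map₂ ih fun p _ => 1 - p
    convert this using 2 with ω
    by_cases h : ω ∈ t <;> simp [h]
  | iUnion f hf ih =>
    have hfm : ∀ n, MeasurableSet (f n) := fun n =>
      hle _ (MeasurableSpace.measurableSet_sup.2 (hf n))
    refine PairApproximable.of_eventually_eq
      (X' := fun n ω => if ω ∈ ⋃ i < n, f i then 1 else 0) (hmeas _ (.iUnion hfm))
      (fun n => hmeas _ (.iUnion fun i => .iUnion fun _ => hfm i)) (fun ω => ?_) (fun n => ?_)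
    · by_cases h : ω ∈ ⋃ i, f i
      · obtain ⟨i, hi⟩ := Set.mem_iUnion.1 h
        refine ⟨i + 1, fun n hn => ?_⟩
        have : ω ∈ ⋃ i < n, f i := Set.mem_biUnion (show i < n from hn) hi
        simp only [if_pos h, if_pos this]
      · refine ⟨0, fun n _ => ?_⟩
        have : ω ∉ ⋃ i < n, f i := fun h' => h (Set.iUnion₂_subset_iUnion _ _ h')
        simp only [if_neg h, if_neg this]
    · induction n with
      | zero => exact .of_left (by simp)
      | succ n ihn =>
        convert ihn.map₂ (ih n) max using 2 with ω
        have e : ω ∈ ⋃ i < n + 1, f i ↔ ω ∈ (⋃ i < n, f i) ∨ ω ∈ f n := by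
          simp only [Set.mem_iUnion, Order.lt_add_one_iff, le_iff_lt_or_eq, exists_prop]
          constructor
          · rintro ⟨i, hi | rfl, h⟩
            · exact .inl ⟨i, hi, h⟩
            · exact .inr h
          · rintro (⟨i, hi, h⟩ | h)
            · exact ⟨i, .inl hi, h⟩
            · exact ⟨n, .inr rfl, h⟩
        simp only [e]
        by_cases h1 : ω ∈ ⋃ i < n, f i <;> by_cases h2 : ω ∈ f n <;>
          simp only [h1, h2, if_true, if_false, or_self, or_true, true_or] <;> rfl

/-- A truncation `min X n` is the sum of the indicators of `k ≤ X` for `1 ≤ k ≤ n`. -/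
theorem pairApproximable [IsFiniteMeasure μ] (h₁ : m₁ ≤ m0) (h₂ : m₂ ≤ m0) {X : Ω → ℕ}
    (hX : Measurable[m₁ ⊔ m₂] X) : PairApproximable μ m₁ m₂ X := by
  classical
  have hX0 : Measurable X := hX.mono (sup_le h₁ h₂) le_rfl
  refine .of_eventually_eq (X' := fun n ω => min (X ω) n) hX0
    (fun n => (measurable_of_countable fun k => min k n).comp hX0)
    (fun ω => ⟨X ω, fun n hn => (min_eq_left hn).symm⟩) fun n => ?_
  induction n with
  | zero => exact .of_left (by simp)
  | succ n ih =>
    have hs : MeasurableSet[m₁ ⊔ m₂] {ω | n + 1 ≤ X ω} := hX (measurableSet_Ici (a := n + 1))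
    convert ih.map₂ (pairApproximable_indicator h₁ h₂ hs) (· + ·) using 2 with ω
    simp only [Set.mem_ofPred_eq]
    split_ifs <;> omega

/-! ### Approximation by partitions into rectangles -/

theorem IsRectangular.natPair {P Z : Ω → ℕ} (h : IsRectangular mA mB fun ω => (P ω, Z ω)) :
    IsRectangular mA mB fun ω => Nat.pair (P ω) (Z ω) := by
  intro i
  obtain ⟨E, F, hE, hF, e⟩ := h i.unpair
  refine ⟨E, F, hE, hF, e ▸ ?_⟩
  ext ω
  simp only [Set.mem_preimage, Set.mem_singleton_iff]
  constructor
  · rintro rfl; simp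
  · intro h
    rw [← Nat.pair_unpair i, ← h]

/-- The information in `g` can be approximated by discrete variables whose level sets are
rectangles, and which are themselves almost determined by `g`. -/
def RectangleApproximable (μ : Measure Ω) (mA mB g : MeasurableSpace Ω) : Prop :=
  ∀ X : Ω → ℕ, Measurable[g] X → ∀ δ : ℝ≥0∞, δ ≠ 0 → ∃ (P P' : Ω → ℕ) (h : ℕ → ℕ),
    IsRectangular mA mB P ∧ Measurable[g] P' ∧ μ {ω | P ω ≠ P' ω} ≤ δ ∧
      μ {ω | X ω ≠ h (P ω)} ≤ δ

theorem RectangleApproximable.symm (h : RectangleApproximable μ mA mB g) :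
    RectangleApproximable μ mB mA g := fun X hX δ hδ => by
  obtain ⟨P, P', φ, h1, h2⟩ := h X hX δ hδ
  exact ⟨P, P', φ, h1.symm, h2⟩

theorem rectangleApproximable_bot : RectangleApproximable μ mA mB ⊥ := by
  intro X hX δ hδ
  obtain ⟨c, hc⟩ := stronglyMeasurable_bot_iff.1 hX.stronglyMeasurable
  refine ⟨fun _ => 0, fun _ => 0, fun _ => c, fun i => ?_, measurable_const, by simp, by simp [hc]⟩
  by_cases hi : 0 = i
  · exact ⟨Set.univ, Set.univ, @MeasurableSet.univ _ mA, @MeasurableSet.univ _ mB, by ext; simp [hi]⟩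
  · exact ⟨∅, ∅, @MeasurableSet.empty _ mA, @MeasurableSet.empty _ mB, by ext; simp [hi]⟩

/-- A message of Alice preserves approximability by rectangles. -/
theorem RectangleApproximable.sup [IsFiniteMeasure μ] {g₁ : MeasurableSpace Ω} (hA : mA ≤ m0)
    (hg : g ≤ m0) (h : RectangleApproximable μ mA mB g) (hg₁ : g₁ ≤ g ⊔ mA) :
    RectangleApproximable μ mA mB (g ⊔ g₁) := by
  intro X hX δ hδ
  have hδ4 : δ / 4 ≠ 0 := ENNReal.div_ne_zero.2 ⟨hδ, by simp⟩
  have e4 : δ / 4 + δ / 4 + δ / 4 + δ / 4 = δ := by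
    rw [add_assoc, add_assoc, ← add_assoc, ← two_mul, ← two_mul, ← mul_assoc, mul_comm]
    norm_num
    exact ENNReal.div_mul_cancel (by simp) (by simp)
  obtain ⟨X₁, X₂, φ, hX₁, hX₂, hφ⟩ :=
    pairApproximable (μ := μ) hg (hg₁.trans (sup_le hg hA)) hX (δ / 4) hδ4
  obtain ⟨X₃, X₄, ψ, hX₃, hX₄, hψ⟩ :=
    pairApproximable (μ := μ) hg hA (hX₂.mono hg₁ le_rfl) (δ / 4) hδ4
  obtain ⟨P, P', χ, hP, hP', hPP', hχ⟩ := h (fun ω => Nat.pair (X₁ ω) (X₃ ω))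
    ((measurable_of_countable (Function.uncurry Nat.pair)).comp (hX₁.prodMk hX₃)) (δ / 4) hδ4
  -- `Z` stands in for the new information `X₂`, but depends only on `P` and Alice's signal, so that
  -- `(P, Z)` is rectangular. Conversely `Z` need not be measurable for `g ⊔ g₁`; its approximation
  -- there is `X₂` itself.
  let Z : Ω → ℕ := fun ω => ψ (χ (P ω)).unpair.2 (X₄ ω)
  have hZm : Measurable[mA ⊔ MeasurableSpace.comap P inferInstance] Z :=
    (measurable_of_countable (Function.uncurry fun p q => ψ (χ p).unpair.2 q)).comp
      (((comap_measurable P).mono le_sup_right le_rfl).prodMk (hX₄.mono le_sup_left le_rfl))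
  have hX₁' : μ {ω | X₁ ω ≠ (χ (P ω)).unpair.1} ≤ δ / 4 := by
    refine le_trans ?_ hχ
    simpa using measure_comp_ne_le (μ := μ) (fun k => (Nat.unpair k).1)
      (fun ω => Nat.pair (X₁ ω) (X₃ ω)) (fun ω => χ (P ω))
  have hX₃' : μ {ω | X₃ ω ≠ (χ (P ω)).unpair.2} ≤ δ / 4 := by
    refine le_trans ?_ hχ
    simpa using measure_comp_ne_le (μ := μ) (fun k => (Nat.unpair k).2)
      (fun ω => Nat.pair (X₁ ω) (X₃ ω)) (fun ω => χ (P ω))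
  have hψZ : μ {ω | ψ (X₃ ω) (X₄ ω) ≠ Z ω} ≤ μ {ω | X₃ ω ≠ (χ (P ω)).unpair.2} :=
    measure_mono fun ω (hω : _ ≠ _) (h : _ = _) => hω (by simp only [Z, h])
  have hZ : μ {ω | X₂ ω ≠ Z ω} ≤ δ / 4 + δ / 4 :=
    (measure_ne_triangle _ (fun ω => ψ (X₃ ω) (X₄ ω)) _).trans (add_le_add hψ
      (hψZ.trans hX₃'))
  refine ⟨fun ω => Nat.pair (P ω) (Z ω), fun ω => Nat.pair (P' ω) (X₂ ω),
    fun k => φ (χ k.unpair.1).unpair.1 k.unpair.2, (hP.prodMk hZm).natPair,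
    (measurable_of_countable (Function.uncurry Nat.pair)).comp
      ((hP'.mono le_sup_left le_rfl).prodMk (hX₂.mono le_sup_right le_rfl)), ?_, ?_⟩
  · refine (measure_comp₂_ne_le Nat.pair _ _ _ _).trans ?_
    have hZ' : μ {ω | Z ω ≠ X₂ ω} ≤ δ / 4 + δ / 4 := by simpa only [ne_comm] using hZ
    calc _ ≤ δ / 4 + (δ / 4 + δ / 4) := add_le_add hPP' hZ'
      _ ≤ δ / 4 + δ / 4 + δ / 4 + δ / 4 := by rw [← add_assoc]; exact le_self_add
      _ = δ := e4
  · simp only [Nat.unpair_pair]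
    refine (measure_ne_triangle _ (fun ω => φ (X₁ ω) (X₂ ω)) _).trans ?_
    calc _ ≤ δ / 4 + (δ / 4 + (δ / 4 + δ / 4)) :=
          add_le_add hφ ((measure_comp₂_ne_le φ _ _ _ _).trans (add_le_add hX₁' hZ))
      _ = δ := by rw [← add_assoc, ← add_assoc, e4]

end Approx

/-! ### Accuracy for general transcripts, from the discrete case. -/

section General

variable {Ω : Type*} {m mA mB g : MeasurableSpace Ω} {m0 : MeasurableSpace Ω}
  {μ : Measure Ω} [IsProbabilityMeasure μ] {Y : Ω → ℝ}

/-- Round the expectation down to a multiple of `δ / 2` and split the resulting discrete variable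
into an `m`-part and a `g`-part. Rounding and splitting each cost `δ / 2`. -/
theorem exists_integral_abs_condExp_sup_sub_le (hm : m ≤ m0) (hg : g ≤ m0)
    (hY : AEStronglyMeasurable Y μ) (hY01 : ∀ᵐ ω ∂μ, Y ω ∈ Set.Icc (0 : ℝ) 1) {δ : ℝ}
    (hδ : 0 < δ) :
    ∃ (X₁ X₂ : Ω → ℕ) (φ : ℕ → ℕ → ℝ), Measurable[m] X₁ ∧ Measurable[g] X₂ ∧
      (∀ p q, φ p q ∈ Set.Icc (0 : ℝ) 1) ∧
      ∫ ω, |μ[Y|m ⊔ g] ω - φ (X₁ ω) (X₂ ω)| ∂μ ≤ δ := by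
  have hle : m ⊔ g ≤ m0 := sup_le hm hg
  have hb := condExp_mem_Icc hle hY hY01
  have hδ2 : 0 < δ / 2 := by positivity
  let X : Ω → ℕ := fun ω => ⌊μ[Y|m ⊔ g] ω / (δ / 2)⌋₊
  have hX : Measurable[m ⊔ g] X :=
    Nat.measurable_floor.comp (stronglyMeasurable_condExp.measurable.div_const _)
  obtain ⟨X₁, X₂, h, h1, h2, h3⟩ :=
    pairApproximable (μ := μ) hm hg hX (ENNReal.ofReal (δ / 2)) (by simpa using hδ2)
  let c : ℕ → ℝ := fun k => min 1 (δ / 2 * k)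
  have hc : ∀ k, c k ∈ Set.Icc (0 : ℝ) 1 := fun k =>
    ⟨le_min zero_le_one (by positivity), min_le_left _ _⟩
  refine ⟨X₁, X₂, fun p q => c (h p q), h1, h2, fun p q => hc _, ?_⟩
  have hX0 : Measurable X := hX.mono hle le_rfl
  have hX' : Measurable fun ω => h (X₁ ω) (X₂ ω) :=
    (measurable_of_countable (Function.uncurry h)).comp
      ((h1.mono hm le_rfl).prodMk (h2.mono hg le_rfl))
  have d1 : ∀ᵐ ω ∂μ, |μ[Y|m ⊔ g] ω - c (X ω)| ≤ δ / 2 := by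
    filter_upwards [hb] with ω hω
    have f1 := Nat.floor_le (div_nonneg hω.1 hδ2.le)
    have f2 := Nat.lt_floor_add_one (μ[Y|m ⊔ g] ω / (δ / 2))
    rw [le_div_iff₀ hδ2] at f1
    rw [div_lt_iff₀ hδ2] at f2
    change (X ω : ℝ) * (δ / 2) ≤ _ at f1
    change _ < ((X ω : ℝ) + 1) * (δ / 2) at f2
    have f3 : c (X ω) = δ / 2 * (X ω) := min_eq_right (by linarith [hω.2])
    rw [f3, abs_le]
    constructor <;> linarith
  have d2 : ∫ ω, |c (X ω) - c (h (X₁ ω) (X₂ ω))| ∂μ ≤ δ / 2 := by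
    have hD : MeasurableSet {ω | X ω ≠ h (X₁ ω) (X₂ ω)} := (measurableSet_eq_fun hX0 hX').compl
    refine (integral_abs_sub_le_measureReal (.of_forall fun ω => hc _) (.of_forall fun ω => hc _)
      hD (.of_forall fun ω hω => ?_)).trans (ENNReal.toReal_le_of_le_ofReal hδ2.le h3)
    have : X ω = h (X₁ ω) (X₂ ω) := not_not.1 hω
    rw [this]
  have hcm : Measurable c := measurable_of_countable c
  have i1 : Integrable (fun ω => c (X ω)) μ :=
    integrable_of_mem_Icc (hcm.comp hX0).aestronglyMeasurable (.of_forall fun ω => hc _)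
  have i2 : Integrable (fun ω => c (h (X₁ ω) (X₂ ω))) μ :=
    integrable_of_mem_Icc (hcm.comp hX').aestronglyMeasurable (.of_forall fun ω => hc _)
  have i3 : Integrable (fun ω => |c (X ω) - c (h (X₁ ω) (X₂ ω))|) μ := (i1.sub i2).abs
  calc ∫ ω, |μ[Y|m ⊔ g] ω - c (h (X₁ ω) (X₂ ω))| ∂μ
      ≤ ∫ ω, (δ / 2 + |c (X ω) - c (h (X₁ ω) (X₂ ω))|) ∂μ := by
        refine integral_mono_ae (integrable_condExp.sub i2).abs
          ((integrable_const _).add i3) ?_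
        filter_upwards [d1] with ω hω
        exact (abs_sub_le _ (c (X ω)) _).trans (add_le_add_left hω _)
    _ ≤ δ := by
        rw [integral_add (integrable_const _) i3]
        simp only [integral_const, probReal_univ, one_smul]
        linarith

/-- If `X₂` almost suffices to predict `Y` along with `m` and is almost a function of `P`, which in
turn is almost a function of `g`, then `P` and `g` yield almost the same prediction. -/
theorem integral_abs_condExp_sup_comap_sub_condExp_le (hm : m ≤ m0) (hg : g ≤ m0)
    (hY : AEStronglyMeasurable Y μ) (hY01 : ∀ᵐ ω ∂μ, Y ω ∈ Set.Icc (0 : ℝ) 1)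
    {X₁ X₂ : Ω → ℕ} {φ : ℕ → ℕ → ℝ} (hX₁ : Measurable[m] X₁) (hX₂ : Measurable[g] X₂)
    (hφ : ∀ p q, φ p q ∈ Set.Icc (0 : ℝ) 1) {δ : ℝ} (hδ : 0 < δ)
    (happrox : ∫ ω, |μ[Y|m ⊔ g] ω - φ (X₁ ω) (X₂ ω)| ∂μ ≤ δ) {P P' : Ω → ℕ} {h : ℕ → ℕ}
    (hP : Measurable P) (hP' : Measurable[g] P') (hPP' : μ {ω | P ω ≠ P' ω} ≤ ENNReal.ofReal δ)
    (hX₂P : μ {ω | X₂ ω ≠ h (P ω)} ≤ ENNReal.ofReal δ) :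
    ∫ ω, |μ[Y|m ⊔ MeasurableSpace.comap P inferInstance] ω - μ[Y|m ⊔ g] ω| ∂μ ≤ 10 * δ := by
  have hmg : m ⊔ g ≤ m0 := sup_le hm hg
  have hK : m ⊔ g ⊔ MeasurableSpace.comap P inferInstance ≤ m0 := sup_le hmg hP.comap_le
  have hmP : m ⊔ MeasurableSpace.comap P inferInstance ≤
      m ⊔ g ⊔ MeasurableSpace.comap P inferInstance := sup_le_sup_right le_sup_left _
  have s1 := integral_abs_condExp_sup_comap_sub_le hmg hY hY01 hP (hP'.mono le_sup_right le_rfl)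
  have s1' : μ.real {ω | P ω ≠ P' ω} ≤ δ := ENNReal.toReal_le_of_le_ofReal hδ.le hPP'
  have hφm : Measurable (Function.uncurry φ) := measurable_of_countable _
  have hf₁ : Measurable[m ⊔ MeasurableSpace.comap P inferInstance]
      fun ω => φ (X₁ ω) (h (P ω)) :=
    hφm.comp ((hX₁.mono le_sup_left le_rfl).prodMk
      ((measurable_of_countable h).comp ((comap_measurable P).mono le_sup_right le_rfl)))
  have hf₁' : Measurable fun ω => φ (X₁ ω) (h (P ω)) := hf₁.mono (hmP.trans hK) le_rfl
  have hf₀ : Measurable fun ω => φ (X₁ ω) (X₂ ω) :=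
    hφm.comp ((hX₁.mono hm le_rfl).prodMk (hX₂.mono hg le_rfl))
  have if₁ : Integrable (fun ω => φ (X₁ ω) (h (P ω))) μ :=
    integrable_of_mem_Icc hf₁'.aestronglyMeasurable (.of_forall fun ω => hφ _ _)
  have if₀ : Integrable (fun ω => φ (X₁ ω) (X₂ ω)) μ :=
    integrable_of_mem_Icc hf₀.aestronglyMeasurable (.of_forall fun ω => hφ _ _)
  have s2 : ∫ ω, |φ (X₁ ω) (X₂ ω) - φ (X₁ ω) (h (P ω))| ∂μ ≤ δ := by
    have hD : MeasurableSet {ω | X₂ ω ≠ h (P ω)} :=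
      (measurableSet_eq_fun (hX₂.mono hg le_rfl) ((measurable_of_countable h).comp hP)).compl
    refine (integral_abs_sub_le_measureReal (.of_forall fun ω => hφ _ _)
      (.of_forall fun ω => hφ _ _) hD (.of_forall fun ω hω => ?_)).trans
      (ENNReal.toReal_le_of_le_ofReal hδ.le hX₂P)
    have : X₂ ω = h (P ω) := not_not.1 hω
    rw [this]
  have s3 := integral_abs_condExp_sub_condExp_le (μ := μ) (Y := Y) hmP hK hf₁.stronglyMeasurable if₁
  set bK := μ[Y|m ⊔ g ⊔ MeasurableSpace.comap P inferInstance]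
  set bP := μ[Y|m ⊔ MeasurableSpace.comap P inferInstance]
  set bg := μ[Y|m ⊔ g]
  have iK : Integrable bK μ := integrable_condExp
  have iP : Integrable bP μ := integrable_condExp
  have ig : Integrable bg μ := integrable_condExp
  have j1 : Integrable (fun ω => |bK ω - bg ω|) μ := (iK.sub ig).abs
  have j2 : Integrable (fun ω => |bg ω - φ (X₁ ω) (X₂ ω)|) μ := (ig.sub if₀).abs
  have j3 : Integrable (fun ω => |φ (X₁ ω) (X₂ ω) - φ (X₁ ω) (h (P ω))|) μ := (if₀.sub if₁).abs
  have j4 : Integrable (fun ω => |bK ω - bP ω|) μ := (iK.sub iP).abs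
  have t1 : ∫ ω, |bK ω - φ (X₁ ω) (h (P ω))| ∂μ ≤ ∫ ω, |bK ω - bg ω| ∂μ +
      ∫ ω, |bg ω - φ (X₁ ω) (X₂ ω)| ∂μ + ∫ ω, |φ (X₁ ω) (X₂ ω) - φ (X₁ ω) (h (P ω))| ∂μ := by
    have j12 : Integrable (fun ω => |bK ω - bg ω| + |bg ω - φ (X₁ ω) (X₂ ω)|) μ := j1.add j2
    rw [← integral_add j1 j2, ← integral_add j12 j3]
    refine integral_mono (iK.sub if₁).abs (j12.add j3) fun ω => ?_
    have a1 := abs_sub_le (bK ω) (bg ω) (φ (X₁ ω) (h (P ω)))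
    have a2 := abs_sub_le (bg ω) (φ (X₁ ω) (X₂ ω)) (φ (X₁ ω) (h (P ω)))
    exact a1.trans ((add_le_add_right a2 _).trans_eq (add_assoc _ _ _).symm)
  have t2 : ∫ ω, |bP ω - bg ω| ∂μ ≤ ∫ ω, |bK ω - bP ω| ∂μ + ∫ ω, |bK ω - bg ω| ∂μ := by
    rw [← integral_add j4 j1]
    refine integral_mono (iP.sub ig).abs (j4.add j1) fun ω => ?_
    have a1 := abs_sub_le (bP ω) (bK ω) (bg ω)
    rwa [abs_sub_comm (bP ω) (bK ω)] at a1
  -- Adjoining `P` to `m ⊔ g` costs `2δ`. Hence `bK` is within `2δ + δ + δ` of a function measurable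
  -- for `m` and `P`, so within `8δ` of `bP`; the total is `8δ + 2δ`.
  linarith

/-- Predictions from approximable information can be approximated by predictions from a partition
into rectangles, for both parties at once. -/
theorem RectangleApproximable.exists_isRectangular (hA : mA ≤ m0) (hB : mB ≤ m0) (hg : g ≤ m0)
    (hY : AEStronglyMeasurable Y μ) (hY01 : ∀ᵐ ω ∂μ, Y ω ∈ Set.Icc (0 : ℝ) 1)
    (h : RectangleApproximable μ mA mB g) {δ : ℝ} (hδ : 0 < δ) :
    ∃ P : Ω → ℕ, IsRectangular mA mB P ∧
      ∫ ω, |μ[Y|mA ⊔ MeasurableSpace.comap P inferInstance] ω - μ[Y|mA ⊔ g] ω| ∂μ ≤ δ ∧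
      ∫ ω, |μ[Y|mB ⊔ MeasurableSpace.comap P inferInstance] ω - μ[Y|mB ⊔ g] ω| ∂μ ≤ δ := by
  have hδ' : 0 < δ / 10 := by positivity
  have e10 : 10 * (δ / 10) = δ := by ring
  obtain ⟨X₁, X₂, φ, hX₁, hX₂, hφ, hap⟩ :=
    exists_integral_abs_condExp_sup_sub_le hA hg hY hY01 hδ'
  obtain ⟨Z₁, Z₂, ψ, hZ₁, hZ₂, hψ, hap'⟩ :=
    exists_integral_abs_condExp_sup_sub_le hB hg hY hY01 hδ'
  obtain ⟨P, P', χ, hP, hP', hPP', hχ⟩ := h (fun ω => Nat.pair (X₂ ω) (Z₂ ω))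
    ((measurable_of_countable (Function.uncurry Nat.pair)).comp (hX₂.prodMk hZ₂))
    (ENNReal.ofReal (δ / 10)) (by simpa using hδ')
  have hPm : Measurable P := hP.measurable.mono (sup_le hA hB) le_rfl
  have hX₂P : μ {ω | X₂ ω ≠ (χ (P ω)).unpair.1} ≤ ENNReal.ofReal (δ / 10) := by
    refine le_trans ?_ hχ
    simpa using measure_comp_ne_le (μ := μ) (fun k => (Nat.unpair k).1)
      (fun ω => Nat.pair (X₂ ω) (Z₂ ω)) (fun ω => χ (P ω))
  have hZ₂P : μ {ω | Z₂ ω ≠ (χ (P ω)).unpair.2} ≤ ENNReal.ofReal (δ / 10) := by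
    refine le_trans ?_ hχ
    simpa using measure_comp_ne_le (μ := μ) (fun k => (Nat.unpair k).2)
      (fun ω => Nat.pair (X₂ ω) (Z₂ ω)) (fun ω => χ (P ω))
  refine ⟨P, hP, ?_, ?_⟩
  · exact e10 ▸ integral_abs_condExp_sup_comap_sub_condExp_le hA hg hY hY01 hX₁ hX₂ hφ hδ' hap hPm
      hP' hPP' (h := fun k => (χ k).unpair.1) hX₂P
  · exact e10 ▸ integral_abs_condExp_sup_comap_sub_condExp_le hB hg hY hY01 hZ₁ hZ₂ hψ hδ' hap' hPm
      hP' hPP' (h := fun k => (χ k).unpair.2) hZ₂P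

theorem exists_abs_integral_negEntropy_sub_le {ζ : ℝ} (hζ : 0 < ζ) :
    ∃ δ > 0, ∀ f f' : Ω → ℝ, AEStronglyMeasurable f μ → AEStronglyMeasurable f' μ →
      (∀ᵐ ω ∂μ, f ω ∈ Set.Icc (0 : ℝ) 1) → (∀ᵐ ω ∂μ, f' ω ∈ Set.Icc (0 : ℝ) 1) →
      ∫ ω, |f ω - f' ω| ∂μ ≤ δ →
      |∫ ω, negEntropy (f ω) ∂μ - ∫ ω, negEntropy (f' ω) ∂μ| ≤ ζ := by
  set l := min 1 (ζ / 4) with hl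
  have hl0 : 0 < l := by positivity
  have hL : 0 ≤ Real.log (1 / l) :=
    Real.log_nonneg (by rw [le_div_iff₀ hl0, one_mul]; exact min_le_left _ _)
  refine ⟨ζ / 4 / (1 + Real.log (1 / l)), by positivity, fun f f' hf hf' h h' hd => ?_⟩
  refine (abs_integral_negEntropy_sub_le hf hf' h h' hl0 (min_le_left _ _)).trans ?_
  have h1 : (∫ ω, |f ω - f' ω| ∂μ) * (1 + Real.log (1 / l)) ≤ ζ / 4 := by
    rwa [le_div_iff₀ (by positivity)] at hd
  have h2 : l ≤ ζ / 4 := min_le_right _ _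
  linarith

theorem integral_jensenBregman {a b : Ω → ℝ} (ham : AEStronglyMeasurable a μ)
    (hbm : AEStronglyMeasurable b μ) (ha : ∀ᵐ ω ∂μ, a ω ∈ Set.Icc (0 : ℝ) 1)
    (hb : ∀ᵐ ω ∂μ, b ω ∈ Set.Icc (0 : ℝ) 1) :
    AEStronglyMeasurable (fun ω => (a ω + b ω) / 2) μ ∧
    (∀ᵐ ω ∂μ, (a ω + b ω) / 2 ∈ Set.Icc (0 : ℝ) 1) ∧
    ∫ ω, jensenBregman (a ω) (b ω) ∂μ =
      (∫ ω, negEntropy (a ω) ∂μ + ∫ ω, negEntropy (b ω) ∂μ) / 2 -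
        ∫ ω, negEntropy ((a ω + b ω) / 2) ∂μ := by
  have h1 : AEStronglyMeasurable (fun ω => (a ω + b ω) / 2) μ := by
    refine ((ham.add hbm).mul_const (2 : ℝ)⁻¹).congr (.of_forall fun ω => ?_)
    simp only [Pi.add_apply, div_eq_mul_inv]
  have h2 : ∀ᵐ ω ∂μ, (a ω + b ω) / 2 ∈ Set.Icc (0 : ℝ) 1 := by
    filter_upwards [ha, hb] with ω h1 h2
    constructor <;> linarith [h1.1, h1.2, h2.1, h2.2]
  refine ⟨h1, h2, ?_⟩
  have i1 := integrable_negEntropy_comp ham ha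
  have i2 := integrable_negEntropy_comp hbm hb
  have i12 : Integrable (fun ω => (negEntropy (a ω) + negEntropy (b ω)) / 2) μ :=
    (i1.add i2).div_const 2
  unfold jensenBregman
  rw [integral_sub i12 (integrable_negEntropy_comp h1 h2), integral_div, integral_add i1 i2]

/-- Agreement implies accuracy for information that is approximable by rectangles. -/
theorem SubstitutesOnRectangles.expNegEntropy_sub_le_of_approximable (hA : mA ≤ m0) (hB : mB ≤ m0)
    (hg : g ≤ m0) (hY : AEStronglyMeasurable Y μ) (hY01 : ∀ᵐ ω ∂μ, Y ω ∈ Set.Icc (0 : ℝ) 1)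
    (h : SubstitutesOnRectangles μ Y mA mB) (happ : RectangleApproximable μ mA mB g)
    {w l δ : ℝ} (hw : 0 < w) (hw2 : w ≤ 1 / 2) (hl : 0 < l) (hl1 : l ≤ 1) (hδ : 0 < δ)
    (hJB : ∫ ω, jensenBregman (μ[Y|mA ⊔ g] ω) (μ[Y|mB ⊔ g] ω) ∂μ ≤ δ) :
    expNegEntropy μ Y (mA ⊔ mB) - expNegEntropy μ Y (mB ⊔ g) ≤
      128 * w ^ 2 + 2 * (2 * (√(16 * δ) / w) * (1 + Real.log (1 / l)) + l) + δ := by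
  obtain ⟨η, hη, hcont⟩ := exists_abs_integral_negEntropy_sub_le (μ := μ)
    (show 0 < δ / 2 by positivity)
  obtain ⟨P, hP, hPA, hPB⟩ := happ.exists_isRectangular hA hB hg hY hY01 hη
  have hP0 : MeasurableSpace.comap P inferInstance ≤ m0 :=
    (hP.measurable.mono (sup_le hA hB) le_rfl).comap_le
  have a1 := condExp_mem_Icc (sup_le hA hP0) hY hY01
  have a2 := condExp_mem_Icc (sup_le hA hg) hY hY01
  have b1 := condExp_mem_Icc (sup_le hB hP0) hY hY01
  have b2 := condExp_mem_Icc (sup_le hB hg) hY hY01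
  have am := fun k : MeasurableSpace Ω =>
    aestronglyMeasurable_condExp (m := k) (m0 := m0) (μ := μ) (Y := Y)
  have cA := hcont _ _ (am _) (am _) a1 a2 hPA
  have cB := hcont _ _ (am _) (am _) b1 b2 hPB
  obtain ⟨m1, c1, e1⟩ := integral_jensenBregman (am _) (am _) a1 b1
  obtain ⟨m2, c2, e2⟩ := integral_jensenBregman (am _) (am _) a2 b2
  have hmid := hcont _ _ m1 m2 c1 c2 (by
    have iA := ((integrable_condExp (m := mA ⊔ MeasurableSpace.comap P inferInstance)
      (μ := μ) (f := Y)).sub (integrable_condExp (m := mA ⊔ g) (μ := μ) (f := Y))).abs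
    have iB := ((integrable_condExp (m := mB ⊔ MeasurableSpace.comap P inferInstance)
      (μ := μ) (f := Y)).sub (integrable_condExp (m := mB ⊔ g) (μ := μ) (f := Y))).abs
    have iAB := (iA.add iB).div_const 2
    refine (integral_mono_of_nonneg (.of_forall fun ω => abs_nonneg _) iAB
      (.of_forall fun ω => ?_)).trans (le_of_eq_of_le (integral_div 2 _) ?_)
    · simp only [Pi.add_apply, Pi.sub_apply]
      rw [← sub_div, abs_div, abs_two]
      gcongr
      rw [add_sub_add_comm]
      exact abs_add_le _ _
    · rw [integral_add' iA iB]
      simp only [Pi.sub_apply]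
      linarith)
  -- Each expected entropy moves by at most `δ / 2`: the two outer ones, averaged, and the one at
  -- the midpoint together add at most `δ`.
  have hJB' : ∫ ω, jensenBregman (μ[Y|mA ⊔ MeasurableSpace.comap P inferInstance] ω)
      (μ[Y|mB ⊔ MeasurableSpace.comap P inferInstance] ω) ∂μ ≤ 2 * δ := by
    rw [e1]
    rw [e2] at hJB
    linarith [(abs_le.1 cA).2, (abs_le.1 cB).2, (abs_le.1 hmid).1]
  have hmain := h.expNegEntropy_sub_le hA hB hY hY01 hP hw hw2 hl hl1 (by positivity) hJB'
  have e16 : 8 * (2 * δ) = 16 * δ := by ring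
  rw [e16] at hmain
  have := (abs_le.1 cB).2
  unfold expNegEntropy at hmain ⊢
  linarith

end General

/-! ### Choice of the mesh -/

/-- With `L = log (1/ε)`, equating `w²` and `√ε L / w` suggests `w = ε^(1/6) L^(1/3) / 4`, where the
factor `1/4` ensures `w ≤ 1/2`. Taking `l = √ε` makes `log (1/l) = L / 2` and keeps `l` of lower
order. As `ε ≤ 1/2`, `L` is bounded below, which absorbs the additive constants. -/
theorem exists_accuracy_const :
    ∃ C : ℝ, 0 < C ∧ ∀ ε : ℝ, 0 < ε → ε ≤ 1 / 2 → ∃ w l : ℝ, 0 < w ∧ w ≤ 1 / 2 ∧ 0 < l ∧ l ≤ 1 ∧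
      128 * w ^ 2 + 2 * (2 * (√(16 * ε) / w) * (1 + Real.log (1 / l)) + l) + ε ≤
        C * ε ^ (1 / 3 : ℝ) * Real.log (1 / ε) ^ (2 / 3 : ℝ) := by
  refine ⟨1000, by norm_num, fun ε hε hε2 => ?_⟩
  set L := Real.log (1 / ε) with hLdef
  have hL2 : Real.log 2 ≤ L :=
    Real.log_le_log two_pos (by rw [le_div_iff₀ hε]; linarith)
  have hL : 1 / 2 < L := by linarith [Real.log_two_gt_d9]
  have hL0 : 0 < L := by linarith
  -- cube roots of `L` and sixth roots of `ε`
  set p := L ^ (1 / 3 : ℝ) with hp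
  set q := ε ^ (1 / 6 : ℝ) with hq
  have hp0 : 0 < p := Real.rpow_pos_of_pos hL0 _
  have hq0 : 0 < q := Real.rpow_pos_of_pos hε _
  have hp3 : p ^ 3 = L := by
    rw [hp, ← Real.rpow_natCast, ← Real.rpow_mul hL0.le]; norm_num
  have hp2 : L ^ (2 / 3 : ℝ) = p ^ 2 := by
    rw [hp, ← Real.rpow_natCast, ← Real.rpow_mul hL0.le]; norm_num
  have hq6 : q ^ 6 = ε := by
    rw [hq, ← Real.rpow_natCast, ← Real.rpow_mul hε.le]; norm_num
  have hq2 : ε ^ (1 / 3 : ℝ) = q ^ 2 := by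
    rw [hq, ← Real.rpow_natCast, ← Real.rpow_mul hε.le]; norm_num
  have hq1 : q < 1 := by
    by_contra hc
    have := one_le_pow₀ (not_lt.1 hc) (n := 6)
    linarith
  have hpl : 1 / 2 < p := by
    by_contra hc
    have := pow_le_pow_left₀ hp0.le (not_lt.1 hc) 3
    rw [hp3] at this
    linarith
  have hqp : q * p ≤ 2 := by
    -- `√ε * log (1 / ε) ≤ 2`
    have h1 : L = 2 * Real.log (1 / q ^ 3) := by
      have : 1 / ε = (1 / q ^ 3) ^ 2 := by rw [← hq6]; field_simp
      rw [hLdef, this, Real.log_pow]; norm_num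
    have h2 := Real.log_le_self (show 0 ≤ 1 / q ^ 3 by positivity)
    have h3 : q ^ 3 * L ≤ 2 := by
      have h4 : L ≤ 2 * (1 / q ^ 3) := by linarith
      calc q ^ 3 * L ≤ q ^ 3 * (2 * (1 / q ^ 3)) := by gcongr
        _ = 2 := by field_simp
    by_contra hc
    have h5 := pow_lt_pow_left₀ (not_le.1 hc) zero_le_two (n := 3) (by norm_num)
    rw [mul_pow, hp3] at h5
    linarith
  have hsq : √(16 * ε) = 4 * q ^ 3 := by
    rw [← hq6, show 16 * q ^ 6 = (4 * q ^ 3) ^ 2 by ring, Real.sqrt_sq (by positivity)]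
  refine ⟨q * p / 4, q ^ 3, by positivity, by linarith, by positivity,
    pow_le_one₀ hq0.le hq1.le, ?_⟩
  have hlog : Real.log (1 / q ^ 3) = L / 2 := by
    have : 1 / ε = (1 / q ^ 3) ^ 2 := by rw [← hq6]; field_simp
    rw [hLdef, this, Real.log_pow]; push_cast; ring
  rw [hsq, hlog, hp2, hq2]
  have e1 : 4 * q ^ 3 / (q * p / 4) = 16 * q ^ 2 / p := by field_simp; ring
  have e2 : 16 * q ^ 2 / p * (1 + L / 2) ≤ 16 * q ^ 2 * (5 / 2 * p ^ 2) := by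
    rw [div_mul_eq_mul_div, div_le_iff₀ hp0]
    have : 1 + L / 2 ≤ 5 / 2 * p ^ 3 := by rw [hp3]; linarith
    calc 16 * q ^ 2 * (1 + L / 2) ≤ 16 * q ^ 2 * (5 / 2 * p ^ 3) := by gcongr
      _ = _ := by ring
  have hp2' : 1 ≤ 4 * p ^ 2 := by nlinarith
  have e3 : q ^ 3 ≤ q ^ 2 * (4 * p ^ 2) := by
    have : q ^ 3 ≤ q ^ 2 := pow_le_pow_of_le_one hq0.le hq1.le (by norm_num)
    nlinarith [sq_nonneg q]
  have e4 : ε ≤ q ^ 2 * (4 * p ^ 2) := by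
    have : q ^ 6 ≤ q ^ 2 := pow_le_pow_of_le_one hq0.le hq1.le (by norm_num)
    rw [← hq6]
    nlinarith [sq_nonneg q]
  rw [mul_assoc 2 (4 * q ^ 3 / (q * p / 4)), e1]
  have : 0 ≤ q ^ 2 * p ^ 2 := by positivity
  nlinarith

/-! ### Transcripts of variable length -/

section Sigma

variable {M : Type*} [MeasurableSpace M]

theorem measurable_sigma_mk {ι : Type*} {β : ι → Type*} [∀ i, MeasurableSpace (β i)] (i : ι) :
    Measurable (Sigma.mk i : β i → Sigma β) := fun _ hs =>
  MeasurableSpace.measurableSet_iInf.1 hs i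

theorem measurable_of_sigma {ι γ : Type*} {β : ι → Type*} [∀ i, MeasurableSpace (β i)]
    [MeasurableSpace γ] {f : Sigma β → γ} (h : ∀ i, Measurable fun x => f ⟨i, x⟩) :
    Measurable f := fun _ hs => MeasurableSpace.measurableSet_iInf.2 fun i => h i hs

theorem measurable_sigma_fst {ι : Type*} [MeasurableSpace ι] {β : ι → Type*}
    [∀ i, MeasurableSpace (β i)] : Measurable (Sigma.fst : Sigma β → ι) :=
  measurable_of_sigma fun _ => measurable_const

open Classical in
/-- The messages of a transcript of length `n`, and a default value for all other transcripts. -/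
def messagesOfLength (c : M) (n : ℕ) (x : Σ n : ℕ, (Fin n → M)) : Fin n → M :=
  if h : x.1 = n then h ▸ x.2 else fun _ => c

omit [MeasurableSpace M] in
@[simp]
theorem messagesOfLength_mk (c : M) (n : ℕ) (q : Fin n → M) :
    messagesOfLength c n ⟨n, q⟩ = q := by simp [messagesOfLength]

theorem measurable_messagesOfLength (c : M) (n : ℕ) : Measurable (messagesOfLength c n) := by
  refine measurable_of_sigma fun k => ?_
  by_cases h : k = n
  · subst h; simpa using measurable_id'
  · simp only [messagesOfLength, dif_neg h]; exact measurable_const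

theorem measurable_finSnoc (n : ℕ) :
    Measurable fun q : (Fin n → M) × M =>
      (Fin.snoc (α := fun _ => M) q.1 q.2 : Fin (n + 1) → M) := by
  refine measurable_pi_iff.2 fun i => ?_
  induction i using Fin.lastCases with
  | last => simpa using measurable_snd
  | cast i => simpa [Function.comp_def] using (measurable_pi_apply i).comp measurable_fst

theorem measurable_finInit (n : ℕ) :
    Measurable fun q : Fin (n + 1) → M => (Fin.init (α := fun _ => M) q : Fin n → M) :=
  measurable_pi_iff.2 fun i => measurable_pi_apply i.castSucc

end Sigma

/-! ### Measurability of the final transcript. -/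

namespace Protocol

variable {S T M : Type*} [MeasurableSpace S] [MeasurableSpace T] [MeasurableSpace M]
  (π : Protocol S T M)

theorem measurable_transcript (n : ℕ) : Measurable fun q : S × T => π.transcript q.1 q.2 n := by
  induction n with
  | zero => exact measurable_const
  | succ n ih =>
    have hmsg : Measurable fun q : S × T => if π.aliceTurn n = true then
        π.alice n (π.transcript q.1 q.2 n) q.1 else π.bob n (π.transcript q.1 q.2 n) q.2 := by
      by_cases h : π.aliceTurn n = true
      · simp only [if_pos h]
        exact (π.measurable_alice n).comp (ih.prodMk measurable_fst)
      · simp only [if_neg h]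
        exact (π.measurable_bob n).comp (ih.prodMk measurable_snd)
    exact (measurable_finSnoc n).comp (ih.prodMk hmsg)

theorem measurable_endTime : Measurable fun q : S × T => π.endTime q.1 q.2 := by
  classical
  have hset : ∀ n, MeasurableSet {q : S × T | π.transcript q.1 q.2 n ∈ π.halt n} := fun n =>
    π.measurable_transcript n (π.measurableSet_halt n)
  -- The second alternative makes `p` satisfiable also when the protocol never ends; the first time
  -- is then `0`, matching `sInf ∅ = 0`.
  let p : S × T → ℕ → Prop := fun q n =>
    π.transcript q.1 q.2 n ∈ π.halt n ∨ ∀ k, π.transcript q.1 q.2 k ∉ π.halt k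
  have hp : ∀ q, ∃ n, p q n := by
    intro q
    by_cases h : ∃ n, π.transcript q.1 q.2 n ∈ π.halt n
    · exact h.imp fun n hn => .inl hn
    · exact ⟨0, .inr (not_exists.1 h)⟩
  have hm : ∀ n, MeasurableSet {q | p q n} := by
    intro n
    have : {q | p q n} = {q : S × T | π.transcript q.1 q.2 n ∈ π.halt n} ∪
        ⋂ k, {q : S × T | π.transcript q.1 q.2 k ∈ π.halt k}ᶜ := by
      ext q; simp [p]
    rw [this]
    exact (hset n).union (.iInter fun k => (hset k).compl)
  have e : (fun q : S × T => π.endTime q.1 q.2) = fun q => Nat.find (hp q) := by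
    funext q
    by_cases h : ∃ n, π.transcript q.1 q.2 n ∈ π.halt n
    · refine ((Nat.find_eq_iff (hp q)).2 ⟨.inl (Nat.sInf_mem h), fun k hk hpk => ?_⟩).symm
      rcases hpk with hpk | hpk
      · exact Nat.notMem_of_lt_sInf hk hpk
      · exact h.elim hpk
    · have h0 : Nat.find (hp q) = 0 := (Nat.find_eq_zero (hp q)).2 (.inr (not_exists.1 h))
      have : {n | π.transcript q.1 q.2 n ∈ π.halt n} = ∅ :=
        Set.eq_empty_of_forall_notMem (not_exists.1 h)
      rw [h0, endTime, this, Nat.sInf_empty]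
  rw [e]
  exact measurable_find hp hm

theorem measurable_finalTranscript :
    Measurable fun q : S × T => π.finalTranscript q.1 q.2 :=
  measurable_apply_of_countable
    (F := fun n (q : S × T) => (⟨n, π.transcript q.1 q.2 n⟩ : Σ n : ℕ, (Fin n → M)))
    π.measurable_endTime fun n => (measurable_sigma_mk n).comp (π.measurable_transcript n)

/-! ### Stopped transcripts -/

open Classical in
/-- Appends the message `f q` to a transcript `q` of length `n` that has not halted. -/
def extend (c : M) (n : ℕ) (f : (Fin n → M) → M) (x : Σ n : ℕ, (Fin n → M)) :
    Σ n : ℕ, (Fin n → M) :=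
  if x.1 = n ∧ messagesOfLength c n x ∉ π.halt n then
    ⟨n + 1, Fin.snoc (α := fun _ => M) (messagesOfLength c n x) (f (messagesOfLength c n x))⟩
  else x

/-- The transcript after at most `n` messages, stopped when the protocol ends. -/
def stopped (c : M) (s : S) (t : T) : ℕ → Σ n : ℕ, (Fin n → M)
  | 0 => ⟨0, Fin.elim0⟩
  | n + 1 => π.extend c n
      (fun q => if π.aliceTurn n = true then π.alice n q s else π.bob n q t) (stopped c s t n)

variable {π} {c : M} {s : S} {t : T}

theorem stopped_eq_of_not_halted {n : ℕ} (h : ∀ k < n, π.transcript s t k ∉ π.halt k) :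
    π.stopped c s t n = ⟨n, π.transcript s t n⟩ := by
  induction n with
  | zero => rfl
  | succ n ih =>
    rw [stopped, ih fun k hk => h k (hk.trans n.lt_succ_self), extend, messagesOfLength_mk,
      if_pos ⟨rfl, h n n.lt_succ_self⟩]
    rfl

theorem stopped_eq_finalTranscript (h : π.Terminates s t) {n : ℕ} (hn : π.endTime s t ≤ n) :
    π.stopped c s t n = π.finalTranscript s t := by
  induction n, hn using Nat.le_induction with
  | base => exact stopped_eq_of_not_halted fun k hk => Nat.notMem_of_lt_sInf hk
  | succ n hn ih =>
    rw [stopped, ih, extend, if_neg]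
    rintro ⟨h1, h2⟩
    have h1 : π.endTime s t = n := h1
    subst h1
    rw [finalTranscript, messagesOfLength_mk] at h2
    exact h2 (Nat.sInf_mem h)

theorem stopped_fst_le (n : ℕ) : (π.stopped c s t n).1 ≤ n := by
  induction n with
  | zero => exact le_rfl
  | succ n ih =>
    rw [stopped]
    generalize (fun q => if π.aliceTurn n = true then π.alice n q s else π.bob n q t) = f
    unfold extend
    split_ifs
    · exact le_rfl
    · exact ih.trans n.le_succ

/-- A stopped transcript has length `n + 1` at time `n + 1` only if a message was just appended;
dropping it recovers the previous one. Hence the information grows with `n`. -/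
theorem exists_stopped_eq_comp (n : ℕ) :
    ∃ φ : (Σ n : ℕ, (Fin n → M)) → Σ n : ℕ, (Fin n → M), Measurable φ ∧
      ∀ (s : S) (t : T), π.stopped c s t n = φ (π.stopped c s t (n + 1)) := by
  classical
  refine ⟨fun x => if x.1 = n + 1 then
    ⟨n, Fin.init (α := fun _ => M) (messagesOfLength c (n + 1) x)⟩ else x, ?_, fun s t => ?_⟩
  · exact Measurable.ite (measurable_sigma_fst (measurableSet_singleton (n + 1)))
      ((measurable_sigma_mk n).comp
        ((measurable_finInit n).comp (measurable_messagesOfLength c (n + 1)))) measurable_id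
  · have hle := stopped_fst_le (π := π) (c := c) (s := s) (t := t) n
    rw [stopped]
    generalize (fun q => if π.aliceTurn n = true then π.alice n q s else π.bob n q t) = f
    generalize π.stopped c s t n = x at hle ⊢
    obtain ⟨k, q⟩ := x
    unfold extend
    split_ifs with h1
    · obtain rfl : k = n := h1.1
      simp only [if_true, messagesOfLength_mk, Fin.init_snoc]
    · have hk : k ≠ n + 1 := by
        have : k ≤ n := hle
        omega
      simp only [if_neg hk]

theorem measurable_extend {X : Type*} [MeasurableSpace X] {n : ℕ} {f : (Fin n → M) → X → M}
    (hf : Measurable fun q : (Fin n → M) × X => f q.1 q.2) :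
    Measurable fun q : (Σ n : ℕ, (Fin n → M)) × X => π.extend c n (fun r => f r q.2) q.1 := by
  have hq : Measurable fun q : (Σ n : ℕ, (Fin n → M)) × X => messagesOfLength c n q.1 :=
    (measurable_messagesOfLength c n).comp measurable_fst
  refine Measurable.ite
    (((measurable_sigma_fst.comp measurable_fst) (measurableSet_singleton n)).inter
      (hq (π.measurableSet_halt n)).compl) ?_ measurable_fst
  exact (measurable_sigma_mk (n + 1)).comp ((measurable_finSnoc n).comp
    (hq.prodMk (hf.comp (hq.prodMk measurable_snd))))

end Protocol

/-! ### The final transcript is approximable by rectangles -/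

namespace Protocol

variable {Ω S T M : Type*} [m0 : MeasurableSpace Ω] [MeasurableSpace S] [MeasurableSpace T]
  [MeasurableSpace M] (π : Protocol S T M) (I : InfoStructure Ω S T)

theorem comap_stopped_succ_le (c : M) (n : ℕ) :
    MeasurableSpace.comap (fun ω => π.stopped c (I.σ ω) (I.τ ω) (n + 1)) inferInstance ≤
      MeasurableSpace.comap (fun ω => π.stopped c (I.σ ω) (I.τ ω) n) inferInstance ⊔
        (if π.aliceTurn n = true then I.aliceInfo else I.bobInfo) := by
  by_cases h : π.aliceTurn n = true
  · rw [if_pos h]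
    refine Measurable.comap_le ?_
    simp only [stopped, if_pos h]
    exact (measurable_extend (π := π) (c := c) (π.measurable_alice n)).comp
      (((comap_measurable _).mono le_sup_left le_rfl).prodMk
        ((comap_measurable I.σ).mono le_sup_right le_rfl))
  · rw [if_neg h]
    refine Measurable.comap_le ?_
    simp only [stopped, if_neg h]
    exact (measurable_extend (π := π) (c := c) (π.measurable_bob n)).comp
      (((comap_measurable _).mono le_sup_left le_rfl).prodMk
        ((comap_measurable I.τ).mono le_sup_right le_rfl))

theorem comap_stopped_le (c : M) (n : ℕ) :
    MeasurableSpace.comap (fun ω => π.stopped c (I.σ ω) (I.τ ω) n) inferInstance ≤ m0 := by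
  induction n with
  | zero => exact measurable_const.comap_le
  | succ n ih =>
    refine (π.comap_stopped_succ_le I c n).trans (sup_le ih ?_)
    split_ifs
    · exact I.measurable_σ.comap_le
    · exact I.measurable_τ.comap_le

theorem rectangleApproximable_stopped (c : M) (n : ℕ) :
    RectangleApproximable I.P I.aliceInfo I.bobInfo
      (MeasurableSpace.comap (fun ω => π.stopped c (I.σ ω) (I.τ ω) n) inferInstance) := by
  induction n with
  | zero =>
    have : MeasurableSpace.comap (fun ω => π.stopped c (I.σ ω) (I.τ ω) 0) inferInstance = ⊥ :=
      MeasurableSpace.comap_const _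
    rw [this]
    exact rectangleApproximable_bot
  | succ n ih =>
    obtain ⟨φ, hφ, hφe⟩ := exists_stopped_eq_comp (π := π) (c := c) n
    have hle : MeasurableSpace.comap (fun ω => π.stopped c (I.σ ω) (I.τ ω) n) inferInstance ≤
        MeasurableSpace.comap (fun ω => π.stopped c (I.σ ω) (I.τ ω) (n + 1)) inferInstance := by
      refine Measurable.comap_le ?_
      simp only [hφe _ _]
      exact hφ.comp (comap_measurable _)
    have hsucc := π.comap_stopped_succ_le I c n
    rw [← sup_eq_right.2 hle]
    by_cases h : π.aliceTurn n = true
    · rw [if_pos h] at hsucc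
      exact ih.sup I.measurable_σ.comap_le (π.comap_stopped_le I c n) hsucc
    · rw [if_neg h] at hsucc
      exact (ih.symm.sup I.measurable_τ.comap_le (π.comap_stopped_le I c n) hsucc).symm

/-- The information in the final transcript. -/
abbrev transcriptInfo : MeasurableSpace Ω :=
  MeasurableSpace.comap (fun ω => π.finalTranscript (I.σ ω) (I.τ ω)) inferInstance

theorem transcriptInfo_le : π.transcriptInfo I ≤ I.aliceInfo ⊔ I.bobInfo :=
  Measurable.comap_le (π.measurable_finalTranscript.comp
    (((comap_measurable I.σ).mono le_sup_left le_rfl).prodMk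
      ((comap_measurable I.τ).mono le_sup_right le_rfl)))

/-- Outside an event of small probability the protocol has ended by a fixed time `N`, and the final
transcript is the one stopped at `N`. Both directions of the approximation are transferred across
this event. -/
theorem rectangleApproximable_transcriptInfo
    (h : ∀ᵐ ω ∂I.P, π.Terminates (I.σ ω) (I.τ ω)) :
    RectangleApproximable I.P I.aliceInfo I.bobInfo (π.transcriptInfo I) := by
  intro X hX δ hδ
  obtain ⟨ω₀⟩ := I.P.nonempty_of_neZero
  -- A default message exists because a probability space is nonempty.
  let c : M := π.alice 0 Fin.elim0 (I.σ ω₀)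
  obtain ⟨ξ, hξ, rfl⟩ := hX.exists_eq_measurable_comp
  have hend : Measurable fun ω => π.endTime (I.σ ω) (I.τ ω) :=
    π.measurable_endTime.comp (I.measurable_σ.prodMk I.measurable_τ)
  have hδ2 := (ENNReal.half_pos hδ).ne'
  obtain ⟨N, hN⟩ := exists_measure_ne_le (μ := I.P) hend
    (X' := fun n ω => min (π.endTime (I.σ ω) (I.τ ω)) n)
    (fun n => (measurable_of_countable fun k => min k n).comp hend)
    (.of_forall fun ω => ⟨_, fun n hn => (min_eq_left hn).symm⟩) hδ2
  have hclose : I.P {ω | π.stopped c (I.σ ω) (I.τ ω) N ≠ π.finalTranscript (I.σ ω) (I.τ ω)} ≤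
      δ / 2 := by
    refine (measure_mono_ae ?_).trans hN
    filter_upwards [h] with ω hω (hne : _ ≠ _) (heq : _ = _)
    exact hne (stopped_eq_finalTranscript hω (by rw [heq]; exact min_le_right _ _))
  obtain ⟨P, P', χ, hP, hP', hPP', hχ⟩ := π.rectangleApproximable_stopped I c N
    (fun ω => ξ (π.stopped c (I.σ ω) (I.τ ω) N)) (hξ.comp (comap_measurable _)) (δ / 2) hδ2
  obtain ⟨p, hp, rfl⟩ := hP'.exists_eq_measurable_comp
  refine ⟨P, fun ω => p (π.finalTranscript (I.σ ω) (I.τ ω)), χ, hP,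
    hp.comp (comap_measurable _), ?_, ?_⟩
  · refine (measure_ne_triangle _ _ _).trans ((add_le_add hPP' ((measure_comp_ne_le p
      (fun ω => π.stopped c (I.σ ω) (I.τ ω) N)
      fun ω => π.finalTranscript (I.σ ω) (I.τ ω)).trans hclose)).trans ?_)
    rw [ENNReal.add_halves]
  · have hclose' : I.P {ω | π.finalTranscript (I.σ ω) (I.τ ω) ≠ π.stopped c (I.σ ω) (I.τ ω) N} ≤
        δ / 2 := by simpa only [ne_comm] using hclose
    refine (measure_ne_triangle _ _ _).trans ((add_le_add ((measure_comp_ne_le ξ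
      (fun ω => π.finalTranscript (I.σ ω) (I.τ ω))
      fun ω => π.stopped c (I.σ ω) (I.τ ω) N).trans hclose') hχ).trans ?_)
    rw [ENNReal.add_halves]

theorem aliceExpectation_eq :
    π.aliceExpectation I = I.P[I.Y|I.aliceInfo ⊔ π.transcriptInfo I] := by
  rw [aliceExpectation, ← MeasurableSpace.comap_prodMk]; rfl

theorem bobExpectation_eq :
    π.bobExpectation I = I.P[I.Y|I.bobInfo ⊔ π.transcriptInfo I] := by
  rw [bobExpectation, ← MeasurableSpace.comap_prodMk]; rfl

end Protocol

/-! ### Conclusion. -/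

theorem jensenBregman_comm (a b : ℝ) : jensenBregman a b = jensenBregman b a := by
  unfold jensenBregman; rw [add_comm a b, add_comm (negEntropy a)]

/-- By the tower property the prediction is also the conditional expectation of the truth, which
takes the place of `Y` in `lintegral_klBregman_condExp`. -/
theorem InfoStructure.lintegral_klBregman_truth {Ω S T : Type*} {m : MeasurableSpace Ω}
    [m0 : MeasurableSpace Ω] [MeasurableSpace S] [MeasurableSpace T] (I : InfoStructure Ω S T)
    (hm : m ≤ I.aliceInfo ⊔ I.bobInfo) :
    ∫⁻ ω, klBregman (I.truth ω) (I.P[I.Y|m] ω) ∂I.P = ENNReal.ofReal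
      (expNegEntropy I.P I.Y (I.aliceInfo ⊔ I.bobInfo) - expNegEntropy I.P I.Y m) := by
  have hle : I.aliceInfo ⊔ I.bobInfo ≤ m0 :=
    sup_le I.measurable_σ.comap_le I.measurable_τ.comap_le
  have hae := condExp_condExp_of_le (μ := I.P) (f := I.Y) hm hle
  rw [I.truth_eq, (lintegral_klBregman_condExp (hm.trans hle) aestronglyMeasurable_condExp
    (condExp_mem_Icc hle I.measurable_Y.aestronglyMeasurable (.of_forall I.Y_mem)) hae.symm).1]
  unfold expNegEntropy
  congr 2
  exact integral_congr_ae (hae.mono fun ω h => by simp only [h])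

theorem mainTheorem7 :
    ∃ C : ℝ, 0 < C ∧ ∀ ε : ℝ, 0 < ε → ε ≤ 1 / 2 →
      ∀ (Ω S T M : Type*) [MeasurableSpace Ω] [MeasurableSpace S] [MeasurableSpace T]
        [MeasurableSpace M] (I : InfoStructure Ω S T) (π : Protocol S T M),
        I.RectangleSubstitutes → π.CausesAgreement I ε →
          π.AliceAccurate I (C * ε ^ (1 / 3 : ℝ) * Real.log (1 / ε) ^ (2 / 3 : ℝ)) ∧
          π.BobAccurate I (C * ε ^ (1 / 3 : ℝ) * Real.log (1 / ε) ^ (2 / 3 : ℝ)) := by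
  obtain ⟨C, hC, hCε⟩ := exists_accuracy_const
  refine ⟨C, hC, fun ε hε hε2 Ω S T M _ _ _ _ I π hRS hCA => ?_⟩
  obtain ⟨w, l, hw, hw2, hl, hl1, hbound⟩ := hCε ε hε hε2
  obtain ⟨hterm, hJB⟩ := hCA
  have hσ := I.measurable_σ.comap_le
  have hτ := I.measurable_τ.comap_le
  have hg := π.transcriptInfo_le I
  have hg0 := hg.trans (sup_le hσ hτ)
  have hY := I.measurable_Y.aestronglyMeasurable (μ := I.P)
  have hY01 : ∀ᵐ ω ∂I.P, I.Y ω ∈ Set.Icc (0 : ℝ) 1 := .of_forall I.Y_mem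
  have hsub := InfoStructure.RectangleSubstitutes.substitutesOnRectangles I hRS
  have happ := π.rectangleApproximable_transcriptInfo I hterm
  rw [π.aliceExpectation_eq, π.bobExpectation_eq] at hJB
  have hB := hsub.expNegEntropy_sub_le_of_approximable hσ hτ hg0 hY hY01 happ hw hw2 hl hl1 hε hJB
  -- The argument so far bounds Bob's inaccuracy. All hypotheses are symmetric, so exchanging the
  -- parties bounds Alice's.
  simp only [jensenBregman_comm (I.P[I.Y|I.aliceInfo ⊔ π.transcriptInfo I] _)] at hJB
  have hA := hsub.symm.expNegEntropy_sub_le_of_approximable hτ hσ hg0 hY hY01 happ.symm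
    hw hw2 hl hl1 hε hJB
  rw [sup_comm I.bobInfo I.aliceInfo] at hA
  constructor
  · rw [Protocol.AliceAccurate, π.aliceExpectation_eq,
      I.lintegral_klBregman_truth (sup_le le_sup_left hg)]
    exact ENNReal.ofReal_le_ofReal (hA.trans hbound)
  · rw [Protocol.BobAccurate, π.bobExpectation_eq,
      I.lintegral_klBregman_truth (sup_le le_sup_right hg)]
    exact ENNReal.ofReal_le_ofReal (hB.trans hbound)

end
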